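/- Setting. Let $(\Omega,\mathcal F)$ be a measurable space. $C_{l,Lip}(\mathbb R^n)$ is the set of $\varphi:\mathbb R^n\to\mathbb R$ with $|\varphi(x)-\varphi(y)|\le C(1+|x|^m+|y|^m)|x-y|$ for some $C>0$, $m\in\mathbb N$; $C_{b,Lip}(\mathbb R^n)$ is the set of bounded Lipschitz functions. Let $\mathscr H$ be a linear space of real measurable functions on $\Omega$ with $\varphi(X_1,\dots,X_n)\in\mathscr H$ whenever $X_1,\dots,X_n\in\mathscr H$ and $\varphi\in C_{l,Lip}(\mathbb R^n)$. Let $\mathbb E:\mathscr H\to[-\infty,\infty]$ be a sub-linear expectation: it is monotone, $\mathbb E[c]=c$ for constants $c$, $\mathbb E[X+Y]\le\mathbb E[X]+\mathbb E[Y]$ unless the right side has the form $\infty-\infty$ or $-\infty+\infty$, and $\mathbb E[\lambda X]=\lambda\mathbb E[X]$ for $\lambda\ge0$ (with $0\cdot\infty=0$). Let $X_1,X_2,\dots\in\mathscr H$ be independent and identically distributed under $\mathbb E$: $\mathbb E[\varphi(X_i)]=\mathbb E[\varphi(X_1)]$ for all $i$ and $\varphi\in C_{b,Lip}(\mathbb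 R)$; and for each $i\ge1$, with $\mathbf X=(X_1,\dots,X_i)$ and $Y=X_{i+1}$, $\mathbb E[\varphi(\mathbf X,Y)]=\mathbb E\big[\mathbb E[\varphi(x,Y)]|_{x=\mathbf X}\big]$ for each $\varphi\in C_{l,Lip}(\mathbb R^i\times\mathbb R)$ such that $\overline\varphi(x):=\mathbb E[|\varphi(x,Y)|]<\infty$ for all $x$ and $\mathbb E[|\overline\varphi(\mathbf X)|]<\infty$ (for those $\varphi$ for which the functions in the outer expectations belong to $\mathscr H$). Put $$\widetilde{\mathscr H}=\{Y=\varphi(X_1,\dots,X_n): n\ge1,\ \varphi\in C_{l,Lip}(\mathbb R^n),\ \mathbb E[(|Y|-c)^+]\to0\text{ as }c\to\infty\},$$ and let $\mathscr H_b$ be the set of bounded elements of $\mathscr H$. Condition (CC). $\mathscr P$ is a family of probability measures on $(\Omega,\sigma(\mathscr H))$ such that $\mathbb E[X]=\sup_{P\in\mathscr P}\int X\,dP$ for all $X\in\mathscr H_b$, and such that for all $Y_1,Y_2,\dots\in\mathscr H_b$ and every sequence $(P_n)$ in $\mathscr P$ there are a subsequence $(n_k)$ and $P\in\mathscr P$ with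 $\int\varphi(Y_1,\dots,Y_d)\,dP_{n_k}\to\int\varphi(Y_1,\dots,Y_d)\,dP$ for all $d\ge1$ and $\varphi\in C_{b,Lip}(\mathbb R^d)$. Capacities. For $A\in\sigma(\mathscr H)$ let $\mathbb V^{\mathscr P}(A)=\sup_{P\in\mathscr P}P(A)$, and for $A\in\mathcal F$ let $$\widehat{\mathbb V}(A)=\inf\{\mathbb E[\xi]: I_A\le\xi\in\mathscr H\},\qquad \widehat{\mathbb V}^*(A)=\inf\Big\{\sum_{n\ge1}\widehat{\mathbb V}(A_n): A\subset\bigcup_{n\ge1}A_n,\ A_n\in\mathcal F\Big\},$$ $$\mathbb C^*(A)=\inf\Big\{\lim_{n\to\infty}\mathbb E\Big[\sum_{i=1}^n g_i\Big]: I_A\le\sum_{n\ge1}g_n,\ 0\le g_n\in\mathscr H\Big\}.$$ Claim. Suppose that (CC) holds. Then for each of $V=\mathbb V^{\mathscr P},\ \mathbb C^*,\ \widehat{\mathbb V}^*,\ \widehat{\mathbb V}$: (i) $\mathbb E[f]\le V(A)\le\mathbb E[g]$ whenever $f\le I_A\le g$ with $f,g\in\mathscr H$ and $A$ in the domain of $V$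 (that is, $A\in\sigma(\mathscr H)$ for $\mathbb V^{\mathscr P}$ and $A\in\mathcal F$ for the other three). (ii) If $V(\bigcap_{n}A_n)>0$ for every sequence of events $A_n\in\sigma(X_1,X_2,\dots)$ with $A_n\supset A_{n+1}$ and $V(A_n)=1$ for all $n$, then $\mathbb E$ is finite and linear on the linear space $\widetilde{\mathscr H}$. -/

import Mathlib

open MeasureTheory Filter Topology
open scoped ENNReal

/-- The class `C_{l,Lip}(V)` of locally Lipschitz functions of polynomial growth:
`|φ x - φ y| ≤ C (1 + |x|^m + |y|^m) |x - y|` for some `C > 0` and `m : ℕ`. On `ℝⁿ` all norms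
are equivalent, so the class does not depend on the norm that is used. -/
def CLLip {V : Type*} [NormedAddCommGroup V] (φ : V → ℝ) : Prop :=
  ∃ C : ℝ, 0 < C ∧ ∃ m : ℕ, ∀ x y : V, |φ x - φ y| ≤ C * (1 + ‖x‖ ^ m + ‖y‖ ^ m) * ‖x - y‖

/-- The class `C_{b,Lip}(V)` of bounded Lipschitz functions. -/
def CBLip {V : Type*} [NormedAddCommGroup V] (φ : V → ℝ) : Prop :=
  (∃ K : ℝ, ∀ x y : V, |φ x - φ y| ≤ K * ‖x - y‖) ∧ ∃ M : ℝ, ∀ x : V, |φ x| ≤ M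

/-- A sub-linear expectation space `(Ω, ℋ, 𝔼)` over the measurable space `Ω`. The values of `E`
outside of `H` have no meaning, and are never used. -/
structure SubLinExpSpace (Ω : Type*) [MeasurableSpace Ω] where
  /-- the linear space `ℋ` of random variables -/
  H : Submodule ℝ (Ω → ℝ)
  measurable_of_mem : ∀ X ∈ H, Measurable X
  comp_mem : ∀ (n : ℕ) (X : Fin n → Ω → ℝ), (∀ i, X i ∈ H) →
    ∀ φ : (Fin n → ℝ) → ℝ, CLLip φ → (fun ω => φ (fun i => X i ω)) ∈ H
  /-- the sub-linear expectation `𝔼 : ℋ → [-∞, ∞]` -/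
  E : (Ω → ℝ) → EReal
  mono : ∀ X ∈ H, ∀ Y ∈ H, (∀ ω, Y ω ≤ X ω) → E Y ≤ E X
  const : ∀ c : ℝ, E (fun _ => c) = c
  subadd : ∀ X ∈ H, ∀ Y ∈ H, ¬ (E X = ⊤ ∧ E Y = ⊥) → ¬ (E X = ⊥ ∧ E Y = ⊤) →
    E (X + Y) ≤ E X + E Y
  pos_homog : ∀ X ∈ H, ∀ l : ℝ, 0 ≤ l → E (l • X) = (l : EReal) * E X

namespace CLLip

variable {V W : Type*} [NormedAddCommGroup V] [NormedAddCommGroup W]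

theorem zero : CLLip (fun _ : V => (0 : ℝ)) :=
  ⟨1, one_pos, 0, fun x y => by simp; positivity⟩

theorem smul {φ : V → ℝ} (h : CLLip φ) (a : ℝ) : CLLip (fun x => a * φ x) := by
  obtain ⟨C, hC, m, hm⟩ := h
  refine ⟨(|a| + 1) * C, by positivity, m, fun x y => ?_⟩
  rw [← mul_sub, abs_mul]
  have h0 := hm x y
  have h1 : 0 ≤ |φ x - φ y| := abs_nonneg _
  calc |a| * |φ x - φ y| ≤ (|a| + 1) * |φ x - φ y| := by nlinarith
    _ ≤ (|a| + 1) * (C * (1 + ‖x‖ ^ m + ‖y‖ ^ m) * ‖x - y‖) := by gcongr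
    _ = _ := by ring

theorem pow_le_pow_add {t : ℝ} (ht : 0 ≤ t) {m k : ℕ} (h : m ≤ k) : t ^ m ≤ 1 + t ^ k := by
  rcases le_total t 1 with h1 | h1
  · have := pow_le_one₀ (n := m) ht h1
    have := pow_nonneg ht k
    linarith
  · have := pow_le_pow_right₀ h1 h
    linarith

theorem weaken {φ : V → ℝ} {C : ℝ} (hC : 0 < C) {m k : ℕ} (hk : m ≤ k)
    (h : ∀ x y : V, |φ x - φ y| ≤ C * (1 + ‖x‖ ^ m + ‖y‖ ^ m) * ‖x - y‖) (x y : V) :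
    |φ x - φ y| ≤ (3 * C) * (1 + ‖x‖ ^ k + ‖y‖ ^ k) * ‖x - y‖ := by
  refine (h x y).trans ?_
  have h1 := pow_le_pow_add (norm_nonneg x) hk
  have h2 := pow_le_pow_add (norm_nonneg y) hk
  have h3 : 0 ≤ ‖x‖ ^ k := by positivity
  have h4 : 0 ≤ ‖y‖ ^ k := by positivity
  have : C * (1 + ‖x‖ ^ m + ‖y‖ ^ m) ≤ 3 * C * (1 + ‖x‖ ^ k + ‖y‖ ^ k) := by nlinarith
  exact mul_le_mul_of_nonneg_right this (norm_nonneg _)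

theorem add {φ ψ : V → ℝ} (h : CLLip φ) (h' : CLLip ψ) : CLLip (fun x => φ x + ψ x) := by
  obtain ⟨C, hC, m, hm⟩ := h
  obtain ⟨D, hD, k, hk⟩ := h'
  refine ⟨3 * C + 3 * D, by positivity, max m k, fun x y => ?_⟩
  have h1 := weaken hC (le_max_left m k) hm x y
  have h2 := weaken hD (le_max_right m k) hk x y
  have h3 : |φ x + ψ x - (φ y + ψ y)| ≤ |φ x - φ y| + |ψ x - ψ y| := by
    rw [show φ x + ψ x - (φ y + ψ y) = (φ x - φ y) + (ψ x - ψ y) by ring]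
    exact abs_add_le _ _
  nlinarith

theorem comp {φ : V → ℝ} (h : CLLip φ) (p : W → V) (hp : ∀ x, ‖p x‖ ≤ ‖x‖)
    (hp' : ∀ x y, ‖p x - p y‖ ≤ ‖x - y‖) : CLLip (fun x => φ (p x)) := by
  obtain ⟨C, hC, m, hm⟩ := h
  refine ⟨C, hC, m, fun x y => (hm _ _).trans ?_⟩
  have := hp x
  have := hp y
  have := hp' x y
  gcongr

theorem posPart_abs_sub (c : ℝ) : CLLip (fun x : Fin 1 → ℝ => max (|x 0| - c) 0) := by
  refine ⟨1, one_pos, 0, fun x y => ?_⟩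
  have h1 : |max (|x 0| - c) 0 - max (|y 0| - c) 0| ≤ |x 0 - y 0| := by
    refine (abs_max_sub_max_le_abs _ _ _).trans ?_
    rw [sub_sub_sub_cancel_right]
    exact abs_abs_sub_abs_le _ _
  have h2 : |x 0 - y 0| ≤ ‖x - y‖ := norm_le_pi_norm (x - y) 0
  have h3 : 0 ≤ ‖x - y‖ := norm_nonneg _
  simp only [pow_zero]
  linarith

end CLLip

namespace SubLinExpSpace

variable {Ω : Type*} [MeasurableSpace Ω] (S : SubLinExpSpace Ω)

/-- `ℋ_b`, the bounded elements of `ℋ`. -/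
def Hb : Set (Ω → ℝ) := {f | f ∈ S.H ∧ ∃ M : ℝ, ∀ ω, |f ω| ≤ M}

/-- The `σ`-field `σ(ℋ)`. -/
abbrev sigmaH : MeasurableSpace Ω :=
  ⨆ f : S.H, MeasurableSpace.comap (f : Ω → ℝ) (borel ℝ)

/-- Two random vectors on the same space are identically distributed. -/
def IdentDistrib {n : ℕ} (X Y : Fin n → Ω → ℝ) : Prop :=
  ∀ φ : (Fin n → ℝ) → ℝ, CBLip φ →
    S.E (fun ω => φ (fun i => X i ω)) = S.E (fun ω => φ (fun i => Y i ω))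

/-- The random vector `Y` is independent to the random vector `X` under `𝔼`: with
`φ̄(x) = 𝔼[|φ(x, Y)|]`, one has `𝔼[φ(X, Y)] = 𝔼[𝔼[φ(x, Y)]|_{x = X}]` for all `φ` of class
`C_{l,Lip}` such that `φ̄(x) < ∞` for all `x` and `𝔼[|φ̄(X)|] < ∞`. As `𝔼` is defined on `ℋ` only,
this is required of those `φ` for which the outer expectations are those of elements of `ℋ`.
If `φ̄(x) < ∞` for all `x` then the inner expectations are finite, and `toReal` is harmless. -/
def IndepTo {m n : ℕ} (Y : Fin n → Ω → ℝ) (X : Fin m → Ω → ℝ) : Prop :=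
  ∀ φ : (Fin m → ℝ) × (Fin n → ℝ) → ℝ, CLLip φ →
    (∀ x : Fin m → ℝ, S.E (fun ω => |φ (x, fun j => Y j ω)|) < ⊤) →
    (fun ω => |(S.E (fun ω' => |φ (fun i => X i ω, fun j => Y j ω')|)).toReal|) ∈ S.H →
    S.E (fun ω => |(S.E (fun ω' => |φ (fun i => X i ω, fun j => Y j ω')|)).toReal|) < ⊤ →
    (fun ω => (S.E (fun ω' => φ (fun i => X i ω, fun j => Y j ω'))).toReal) ∈ S.H →
    S.E (fun ω => φ (fun i => X i ω, fun j => Y j ω)) =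
      S.E (fun ω => (S.E (fun ω' => φ (fun i => X i ω, fun j => Y j ω'))).toReal)

/-- The sequence `X 0, X 1, …` consists of independent and identically distributed random
variables. -/
structure IsIID (X : ℕ → Ω → ℝ) : Prop where
  mem : ∀ n, X n ∈ S.H
  ident : ∀ n, S.IdentDistrib (fun _ : Fin 1 => X n) (fun _ : Fin 1 => X 0)
  indep : ∀ n, S.IndepTo (fun _ : Fin 1 => X (n + 1)) (fun i : Fin (n + 1) => X i)

/-- Condition (CC): on `ℋ_b`, `𝔼` is the upper expectation of the family `Ps` of probability
measures on `σ(ℋ)`, and `Ps` is countable-dimensionally weakly compact. -/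
structure CC (Ps : Set (@Measure Ω S.sigmaH)) : Prop where
  isProb : ∀ P ∈ Ps, IsProbabilityMeasure P
  repr : ∀ f ∈ S.Hb, S.E f = ⨆ P ∈ Ps, ((∫ ω, f ω ∂P : ℝ) : EReal)
  compact : ∀ Y : ℕ → Ω → ℝ, (∀ i, Y i ∈ S.Hb) →
    ∀ Q : ℕ → @Measure Ω S.sigmaH, (∀ n, Q n ∈ Ps) →
      ∃ k : ℕ → ℕ, StrictMono k ∧ ∃ P ∈ Ps,
        ∀ d : ℕ, 1 ≤ d → ∀ φ : (Fin d → ℝ) → ℝ, CBLip φ →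
          Tendsto (fun j => ∫ ω, φ (fun i => Y i ω) ∂(Q (k j))) atTop
            (𝓝 (∫ ω, φ (fun i => Y i ω) ∂P))

/-- `I_A ≤ g`. -/
def IndLE (A : Set Ω) (g : Ω → ℝ) : Prop := ∀ ω, A.indicator (fun _ => (1 : ℝ)) ω ≤ g ω

/-- `V^𝒫(A) = sup_{P ∈ Ps} P(A)`; to be used for `A ∈ σ(ℋ)`. -/
noncomputable def capP (Ps : Set (@Measure Ω S.sigmaH)) (A : Set Ω) : ℝ≥0∞ := ⨆ P ∈ Ps, P A

/-- `V̂(A) = inf {𝔼[ξ] : I_A ≤ ξ, ξ ∈ ℋ}`. All these `𝔼[ξ]` are nonnegative. -/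
noncomputable def capHat (A : Set Ω) : ℝ≥0∞ :=
  ⨅ (ξ : Ω → ℝ) (_ : ξ ∈ S.H) (_ : IndLE A ξ), (S.E ξ).toENNReal

/-- `V̂*(A) = inf {∑ₙ V̂(Aₙ) : A ⊆ ⋃ₙ Aₙ}`, with measurable `Aₙ`. -/
noncomputable def capHatStar (A : Set Ω) : ℝ≥0∞ :=
  ⨅ (B : ℕ → Set Ω) (_ : ∀ n, MeasurableSet (B n)) (_ : A ⊆ ⋃ n, B n), ∑' n, S.capHat (B n)

/-- `C*(A) = inf {limₙ 𝔼[g₁ + ⋯ + gₙ] : I_A ≤ ∑ₙ gₙ, 0 ≤ gₙ ∈ ℋ}`. The sum `∑ₙ gₙ` may take the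
value `∞`; the limit is that of a nondecreasing sequence in `[0, ∞]`, so it is a supremum. -/
noncomputable def capC (A : Set Ω) : ℝ≥0∞ :=
  ⨅ (g : ℕ → Ω → ℝ) (_ : ∀ n, g n ∈ S.H ∧ ∀ ω, 0 ≤ g n ω)
    (_ : ∀ ω, A.indicator (fun _ => (1 : ℝ≥0∞)) ω ≤ ∑' n, ENNReal.ofReal (g n ω)),
    ⨆ n : ℕ, (S.E (∑ i ∈ Finset.range n, g i)).toENNReal

/-- The bracketing property: `𝔼[f] ≤ V(A) ≤ 𝔼[g]` whenever `f ≤ I_A ≤ g`, `f, g ∈ ℋ` and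
`A ∈ 𝒢`. -/
def Brackets (𝒢 : Set (Set Ω)) (V : Set Ω → ℝ≥0∞) : Prop :=
  ∀ A ∈ 𝒢, ∀ f ∈ S.H, ∀ g ∈ S.H,
    (∀ ω, f ω ≤ A.indicator (fun _ => (1 : ℝ)) ω) → IndLE A g →
      S.E f ≤ (V A : EReal) ∧ (V A : EReal) ≤ S.E g

/-- On the `σ`-field `𝒢`, `V` is positive on the intersection of any decreasing sequence of events
of capacity one. -/
def PosOnDecreasing (𝒢 : Set (Set Ω)) (V : Set Ω → ℝ≥0∞) : Prop :=
  ∀ A : ℕ → Set Ω, (∀ n, A n ∈ 𝒢) → (∀ n, A (n + 1) ⊆ A n) →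
    (∀ n, V (A n) = 1) → 0 < V (⋂ n, A n)

/-- `𝔼[(|Y| - c)⁺] → 0` as `c → ∞`. -/
def TailVanishes (Y : Ω → ℝ) : Prop :=
  Tendsto (fun c : ℝ => S.E (fun ω => max (|Y ω| - c) 0)) atTop (𝓝 0)

/-- The `σ`-field `σ(X 0, X 1, …)`. -/
abbrev sigmaSeq (X : ℕ → Ω → ℝ) : MeasurableSpace Ω :=
  ⨆ n, MeasurableSpace.comap (X n) (borel ℝ)

variable {S}

theorem tail_mem {Y : Ω → ℝ} (hY : Y ∈ S.H) (c : ℝ) : (fun ω => max (|Y ω| - c) 0) ∈ S.H :=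
  S.comp_mem 1 (fun _ => Y) (fun _ => hY) _ (CLLip.posPart_abs_sub c)

theorem E_nonneg {Y : Ω → ℝ} (hY : Y ∈ S.H) (h : ∀ ω, 0 ≤ Y ω) : 0 ≤ S.E Y := by
  have := S.mono Y hY 0 S.H.zero_mem h
  have h0 : S.E 0 = 0 := S.const 0
  rwa [h0] at this

theorem E_ne_bot {Y : Ω → ℝ} (hY : Y ∈ S.H) (h : ∀ ω, 0 ≤ Y ω) : S.E Y ≠ ⊥ := fun hb => by
  have := E_nonneg hY h
  simp [hb] at this

theorem TailVanishes.zero : S.TailVanishes 0 := by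
  refine tendsto_const_nhds.congr' ?_
  filter_upwards [eventually_ge_atTop (0 : ℝ)] with c hc
  have : (fun ω : Ω => max (|(0 : Ω → ℝ) ω| - c) 0) = fun _ => (0 : ℝ) := by
    funext ω
    simp [hc]
  rw [this, S.const]
  rfl

theorem TailVanishes.add {Y Z : Ω → ℝ} (hY : Y ∈ S.H) (hZ : Z ∈ S.H)
    (h : S.TailVanishes Y) (h' : S.TailVanishes Z) : S.TailVanishes (Y + Z) := by
  have half : Tendsto (fun c : ℝ => c / 2) atTop atTop :=
    tendsto_id.atTop_div_const (by norm_num)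
  have hsum : Tendsto (fun c : ℝ => S.E (fun ω => max (|Y ω| - c / 2) 0)
      + S.E (fun ω => max (|Z ω| - c / 2) 0)) atTop (𝓝 0) := by
    have hc : ContinuousAt (fun p : EReal × EReal => p.1 + p.2) (0, 0) :=
      EReal.continuousAt_add (by simp) (by simp)
    have := hc.tendsto.comp ((h.comp half).prodMk_nhds (h'.comp half))
    simpa [Function.comp_def] using this
  refine tendsto_of_tendsto_of_tendsto_of_le_of_le tendsto_const_nhds hsum
    (fun c => E_nonneg (tail_mem (S.H.add_mem hY hZ) c) fun ω => le_max_right _ _) fun c => ?_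
  have hYm := tail_mem hY (c / 2)
  have hZm := tail_mem hZ (c / 2)
  refine le_trans (S.mono _ (S.H.add_mem hYm hZm) _ (tail_mem (S.H.add_mem hY hZ) c) ?_)
    (S.subadd _ hYm _ hZm (fun hh => E_ne_bot hZm (fun ω => le_max_right _ _) hh.2)
      (fun hh => E_ne_bot hYm (fun ω => le_max_right _ _) hh.1))
  intro ω
  have := abs_add_le (Y ω) (Z ω)
  have h1 := le_max_left (|Y ω| - c / 2) 0
  have h2 := le_max_left (|Z ω| - c / 2) 0
  have h3 := le_max_right (|Y ω| - c / 2) 0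
  have h4 := le_max_right (|Z ω| - c / 2) 0
  simp only [Pi.add_apply]
  exact max_le (by linarith) (by linarith)

theorem TailVanishes.smul {Y : Ω → ℝ} (hY : Y ∈ S.H) (h : S.TailVanishes Y) (a : ℝ) :
    S.TailVanishes (a • Y) := by
  rcases eq_or_ne a 0 with rfl | ha
  · rw [zero_smul]
    exact TailVanishes.zero
  have ha' : 0 < |a| := abs_pos.mpr ha
  have hc : ContinuousAt (fun p : EReal × EReal => p.1 * p.2) (((|a| : ℝ) : EReal), 0) :=
    EReal.continuousAt_mul (by simp) (by simp) (by simp) (by simp)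
  have hd : Tendsto (fun c : ℝ => c / |a|) atTop atTop := tendsto_id.atTop_div_const ha'
  have := hc.tendsto.comp ((tendsto_const_nhds (x := ((|a| : ℝ) : EReal))).prodMk_nhds (h.comp hd))
  simp only [Function.comp_def, mul_zero] at this
  refine this.congr fun c => ?_
  rw [← S.pos_homog _ (tail_mem hY _) _ ha'.le]
  congr 1
  funext ω
  simp only [Pi.smul_apply, smul_eq_mul, abs_mul]
  rw [mul_max_of_nonneg _ _ ha'.le, mul_zero, mul_sub, mul_div_cancel₀ _ ha'.ne']

/-- The subspace `ℋ̃` of all `Y = φ(X₁, …, Xₙ)`, `n ≥ 1`, with `φ` of class `C_{l,Lip}(ℝⁿ)`, such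
that `𝔼[(|Y| - c)⁺] → 0` as `c → ∞`. -/
def Htilde (S : SubLinExpSpace Ω) (X : ℕ → Ω → ℝ) (hX : ∀ n, X n ∈ S.H) :
    Submodule ℝ (Ω → ℝ) where
  carrier := {Y | (∃ n : ℕ, 1 ≤ n ∧ ∃ φ : (Fin n → ℝ) → ℝ, CLLip φ ∧
    Y = fun ω => φ (fun i => X i ω)) ∧ S.TailVanishes Y}
  zero_mem' := ⟨⟨1, le_rfl, fun _ => 0, CLLip.zero, rfl⟩, TailVanishes.zero⟩
  add_mem' := by
    rintro Y Z ⟨⟨n, hn, φ, hφ, rfl⟩, hYt⟩ ⟨⟨m, hm, ψ, hψ, rfl⟩, hZt⟩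
    refine ⟨⟨n + m, by omega, fun x => φ (fun i => x (Fin.castLE (Nat.le_add_right n m) i))
      + ψ (fun i => x (Fin.castLE (Nat.le_add_left m n) i)), ?_, rfl⟩,
      TailVanishes.add (S.comp_mem _ _ (fun i => hX i) φ hφ)
        (S.comp_mem _ _ (fun i => hX i) ψ hψ) hYt hZt⟩
    exact (hφ.comp _ (fun x => (pi_norm_le_iff_of_nonneg (norm_nonneg x)).2
        fun i => norm_le_pi_norm x _)
      (fun x y => (pi_norm_le_iff_of_nonneg (norm_nonneg _)).2
        fun i => norm_le_pi_norm (x - y) _)).add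
      (hψ.comp _ (fun x => (pi_norm_le_iff_of_nonneg (norm_nonneg x)).2
        fun i => norm_le_pi_norm x _)
      (fun x y => (pi_norm_le_iff_of_nonneg (norm_nonneg _)).2
        fun i => norm_le_pi_norm (x - y) _))
  smul_mem' := by
    rintro a Y ⟨⟨n, hn, φ, hφ, rfl⟩, hYt⟩
    exact ⟨⟨n, hn, fun x => a * φ x, hφ.smul a, rfl⟩,
      TailVanishes.smul (S.comp_mem _ _ (fun i => hX i) φ hφ) hYt a⟩

/-- `𝔼` is (finite and) linear on the linear subspace `W` of `ℋ`. -/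
def LinearOn (S : SubLinExpSpace Ω) (W : Submodule ℝ (Ω → ℝ)) : Prop :=
  ∃ L : W →ₗ[ℝ] ℝ, ∀ Y : W, S.E (Y : Ω → ℝ) = (L Y : ℝ)

end SubLinExpSpace

/-! On `σ(ℋ)` the capacities satisfy `capP ≤ capC ≤ capHatStar ≤ capHat`, the last two inequalities
holding on all of `ℱ`. Hence in (i) the upper bound is needed only for `capHat`, where it is the
definition. The lower bound comes from integrating `f⁺`, which is bounded, against each measure of
`Ps`.

For (ii), let `f` be bounded Lipschitz, `u = 𝔼[f(X₀)]` and `v = 𝔼[-f(X₀)]`, so that `-v ≤ u`. Fix `m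
∈ [-v, u]` and put `Sⱼ = ∑_{i<j} (f(Xᵢ) - m)`. The increment `Z = f(Xⱼ) - m` has `𝔼[Z] ≥ 0` and
`𝔼[-Z] ≥ 0`, so `𝔼[tZ] ≥ 0` for every real `t`. In the recursion given by independence, the cross
terms of the squares therefore do no harm, and `𝔼[-∑_{j<d} j⁻³ Sⱼ²]` is bounded below uniformly in
`d`. Weak compactness then yields a single `P ∈ Ps` under which `∑ j⁻³ Sⱼ²` is integrable, hence
almost surely finite (`IsIID.exists_measure_eq_one`).

The series cannot converge at one point for two values `m ≠ m'`: the two sums differ by `j(m' - m)`,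
and `∑ j⁻³ j²` diverges (`eq_of_squareSeries_ne_top`). If `-v < u`, infinitely many values of `m`
thus give pairwise disjoint events of capacity one. The unions of the tails of this sequence of
events still have capacity one and decrease to `∅`, against the assumption on `V`. So `v = -u`
(`IsIID.neg_expect_neg_eq`).

The relation `𝔼[-Y] = -𝔼[Y]` passes to bounded Lipschitz functions of several variables by
independence, to bounded `C_{l,Lip}` functions by tightness, and to `ℋ̃` by truncating values.
Together with sub-additivity it gives linearity. -/

namespace CBLip

/-! ### Stability of the class `C_{b,Lip}`. -/

variable {V W : Type*} [NormedAddCommGroup V] [NormedAddCommGroup W]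

theorem exists_nonneg {φ : V → ℝ} (h : CBLip φ) : ∃ K M : ℝ, 0 ≤ K ∧ 0 ≤ M ∧
    (∀ x y, |φ x - φ y| ≤ K * ‖x - y‖) ∧ ∀ x, |φ x| ≤ M := by
  obtain ⟨⟨K, hK⟩, M, hM⟩ := h
  refine ⟨|K|, M, abs_nonneg K, (abs_nonneg _).trans (hM 0), fun x y => (hK x y).trans ?_, hM⟩
  gcongr
  exact le_abs_self K

theorem toCLLip {φ : V → ℝ} (h : CBLip φ) : CLLip φ := by
  obtain ⟨K, M, hK, -, h1, -⟩ := h.exists_nonneg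
  refine ⟨K + 1, by positivity, 0, fun x y => (h1 x y).trans ?_⟩
  have := norm_nonneg (x - y)
  simp only [pow_zero]
  nlinarith

theorem const (c : ℝ) : CBLip (fun _ : V => c) :=
  ⟨⟨0, fun x y => by simp⟩, |c|, fun _ => le_rfl⟩

theorem add {φ ψ : V → ℝ} (h : CBLip φ) (h' : CBLip ψ) : CBLip (fun x => φ x + ψ x) := by
  obtain ⟨⟨K, hK⟩, M, hM⟩ := h
  obtain ⟨⟨L, hL⟩, N, hN⟩ := h'
  refine ⟨⟨K + L, fun x y => ?_⟩, M + N, fun x =>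
    (abs_add_le _ _).trans (add_le_add (hM x) (hN x))⟩
  rw [add_sub_add_comm, add_mul]
  exact (abs_add_le _ _).trans (add_le_add (hK x y) (hL x y))

theorem mul {φ ψ : V → ℝ} (h : CBLip φ) (h' : CBLip ψ) : CBLip (fun x => φ x * ψ x) := by
  obtain ⟨K, M, hK0, hM0, hK, hM⟩ := h.exists_nonneg
  obtain ⟨L, N, hL0, hN0, hL, hN⟩ := h'.exists_nonneg
  refine ⟨⟨M * L + N * K, fun x y => ?_⟩, M * N, fun x => ?_⟩
  · rw [show φ x * ψ x - φ y * ψ y = φ x * (ψ x - ψ y) + ψ y * (φ x - φ y) by ring]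
    refine (abs_add_le _ _).trans ?_
    rw [abs_mul, abs_mul, add_mul, mul_assoc, mul_assoc]
    exact add_le_add (mul_le_mul (hM x) (hL x y) (abs_nonneg _) hM0)
      (mul_le_mul (hN y) (hK x y) (abs_nonneg _) hN0)
  · rw [abs_mul]
    exact mul_le_mul (hM x) (hN x) (abs_nonneg _) hM0

theorem neg {φ : V → ℝ} (h : CBLip φ) : CBLip (fun x => -φ x) := by
  simpa using (const (V := V) (-1)).mul h

theorem comp {φ : V → ℝ} (h : CBLip φ) (p : W → V)
    (hp : ∀ x y, ‖p x - p y‖ ≤ ‖x - y‖) : CBLip (fun x => φ (p x)) := by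
  obtain ⟨K, M, hK0, -, hK, hM⟩ := h.exists_nonneg
  exact ⟨⟨K, fun x y => (hK _ _).trans (mul_le_mul_of_nonneg_left (hp x y) hK0)⟩,
    M, fun x => hM _⟩

theorem continuous {φ : V → ℝ} (h : CBLip φ) : Continuous φ := by
  obtain ⟨K, M, hK0, -, hK, -⟩ := h.exists_nonneg
  exact (LipschitzWith.of_dist_le_mul (K := K.toNNReal) fun x y => by
    simpa [Real.dist_eq, dist_eq_norm, hK0] using hK x y).continuous

end CBLip

/-! ### Truncation of values and of arguments. -/

/-- The truncation of `t` to `[-c, c]`. -/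
def clamp (c t : ℝ) : ℝ := max (-c) (min c t)

theorem abs_clamp_sub_clamp_le (c s t : ℝ) : |clamp c s - clamp c t| ≤ |s - t| := by
  unfold clamp
  have h1 := abs_max_sub_max_le_max (-c) (min c s) (-c) (min c t)
  have h2 := abs_min_sub_min_le_max c s c t
  simp only [sub_self, abs_zero, abs_nonneg, sup_of_le_right] at h1 h2
  exact h1.trans h2

theorem abs_clamp_le {c : ℝ} (hc : 0 ≤ c) (t : ℝ) : |clamp c t| ≤ c :=
  abs_le.2 ⟨le_max_left _ _, max_le (by linarith) (min_le_left _ _)⟩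

theorem clamp_of_abs_le {c t : ℝ} (h : |t| ≤ c) : clamp c t = t := by
  rw [clamp, min_eq_right (abs_le.1 h).2, max_eq_right (abs_le.1 h).1]

theorem abs_sub_clamp_le {c : ℝ} (hc : 0 ≤ c) (t : ℝ) : |t - clamp c t| ≤ max (|t| - c) 0 := by
  rcases le_total (|t|) c with h | h
  · simp [clamp_of_abs_le h]
  · rw [max_eq_left (by linarith), clamp]
    rcases abs_cases t with ⟨h1, h2⟩ | ⟨h1, h2⟩
    · rw [min_eq_left (by linarith), max_eq_right (by linarith), abs_of_nonneg (by linarith)]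
      linarith
    · rw [min_eq_right (by linarith), max_eq_left (by linarith), abs_of_nonpos (by linarith)]
      linarith

theorem CLLip.of_lipschitz_comp {V : Type*} [NormedAddCommGroup V] {φ : V → ℝ} (h : CLLip φ)
    (p : ℝ → ℝ) (hp : ∀ s t, |p s - p t| ≤ |s - t|) : CLLip (fun x => p (φ x)) := by
  obtain ⟨C, hC, m, hm⟩ := h
  exact ⟨C, hC, m, fun x y => (hp _ _).trans (hm x y)⟩

theorem CLLip.coord {n : ℕ} (i : Fin n) : CLLip (fun x : Fin n → ℝ => x i) :=
  ⟨1, one_pos, 0, fun x y => by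
    have h2 : |x i - y i| ≤ ‖x - y‖ := norm_le_pi_norm (x - y) i
    have := norm_nonneg (x - y)
    simp only [pow_zero]
    linarith⟩

theorem CBLip.clamp_coord {n : ℕ} (i : Fin n) {c : ℝ} (hc : 0 ≤ c) :
    CBLip (fun x : Fin n → ℝ => clamp c (x i)) :=
  ⟨⟨1, fun x y => (abs_clamp_sub_clamp_le _ _ _).trans
    ((norm_le_pi_norm (x - y) i).trans (one_mul _).ge)⟩, c, fun _ => abs_clamp_le hc _⟩

/-- A function of class `C_{l,Lip}(ℝⁿ)` becomes bounded and Lipschitz when its arguments are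
truncated. -/
theorem CLLip.comp_clamp {n : ℕ} {φ : (Fin n → ℝ) → ℝ} (h : CLLip φ) {R : ℝ} (hR : 0 ≤ R) :
    CBLip (fun x : Fin n → ℝ => φ (fun i => clamp R (x i))) := by
  obtain ⟨C, hC, m, hm⟩ := h
  have hn : ∀ x : Fin n → ℝ, ‖fun i => clamp R (x i)‖ ≤ R := fun x =>
    (pi_norm_le_iff_of_nonneg hR).2 fun i => abs_clamp_le hR _
  have hl : ∀ x y : Fin n → ℝ,
      ‖(fun i => clamp R (x i)) - fun i => clamp R (y i)‖ ≤ ‖x - y‖ := fun x y =>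
    (pi_norm_le_iff_of_nonneg (norm_nonneg _)).2 fun i =>
      (abs_clamp_sub_clamp_le _ _ _).trans (norm_le_pi_norm (x - y) i)
  refine ⟨⟨C * (1 + R ^ m + R ^ m), fun x y => (hm _ _).trans ?_⟩,
    |φ 0| + C * (1 + R ^ m + (0 : ℝ) ^ m) * R, fun x => ?_⟩
  · gcongr
    exacts [hn x, hn y, hl x y]
  · have h1 := hm (fun i => clamp R (x i)) 0
    have h2 : C * (1 + ‖fun i => clamp R (x i)‖ ^ m + ‖(0 : Fin n → ℝ)‖ ^ m) *
        ‖(fun i => clamp R (x i)) - 0‖ ≤ C * (1 + R ^ m + (0 : ℝ) ^ m) * R := by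
      rw [sub_zero, norm_zero]
      gcongr
      exacts [hn x, hn x]
    have h3 := abs_add_le (φ 0) (φ (fun i => clamp R (x i)) - φ 0)
    rw [add_sub_cancel] at h3
    linarith

/-! ### Bounded elements of `ℋ` and the real-valued expectation. -/

namespace SubLinExpSpace

variable {Ω : Type*} [MeasurableSpace Ω] {S : SubLinExpSpace Ω}

theorem comp_lipschitz_mem {Y : Ω → ℝ} (hY : Y ∈ S.H) (p : ℝ → ℝ)
    (hp : ∀ s t, |p s - p t| ≤ |s - t|) : (fun ω => p (Y ω)) ∈ S.H :=
  S.comp_mem 1 (fun _ => Y) (fun _ => hY) _ ((CLLip.coord 0).of_lipschitz_comp p hp)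

theorem const_mem (c : ℝ) : (fun _ => c) ∈ S.H :=
  S.comp_mem 0 (fun _ _ => 0) (fun i => i.elim0) _ (CBLip.const c).toCLLip

theorem Hb.const (c : ℝ) : (fun _ => c) ∈ S.Hb := ⟨const_mem c, |c|, fun _ => le_rfl⟩

theorem Hb.add {f g : Ω → ℝ} (hf : f ∈ S.Hb) (hg : g ∈ S.Hb) : f + g ∈ S.Hb := by
  obtain ⟨hf, M, hM⟩ := hf
  obtain ⟨hg, N, hN⟩ := hg
  exact ⟨S.H.add_mem hf hg, M + N, fun ω => (abs_add_le _ _).trans (add_le_add (hM ω) (hN ω))⟩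

theorem Hb.smul {f : Ω → ℝ} (hf : f ∈ S.Hb) (a : ℝ) : a • f ∈ S.Hb := by
  obtain ⟨hf, M, hM⟩ := hf
  refine ⟨S.H.smul_mem a hf, |a| * M, fun ω => ?_⟩
  rw [Pi.smul_apply, smul_eq_mul, abs_mul]
  exact mul_le_mul_of_nonneg_left (hM ω) (abs_nonneg a)

theorem Hb.neg {f : Ω → ℝ} (hf : f ∈ S.Hb) : -f ∈ S.Hb := by
  simpa using Hb.smul hf (-1)

theorem Hb.clamp {f : Ω → ℝ} (hf : f ∈ S.H) {c : ℝ} (hc : 0 ≤ c) :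
    (fun ω => clamp c (f ω)) ∈ S.Hb :=
  ⟨comp_lipschitz_mem hf _ (abs_clamp_sub_clamp_le c), c, fun _ => abs_clamp_le hc _⟩

variable (S) in
/-- The sub-linear expectation as a real number; to be used for finite expectations. -/
noncomputable def expect (f : Ω → ℝ) : ℝ := (S.E f).toReal

theorem E_le_const {f : Ω → ℝ} (hf : f ∈ S.H) {c : ℝ} (h : ∀ ω, f ω ≤ c) : S.E f ≤ c :=
  S.const c ▸ S.mono _ (const_mem c) _ hf h

theorem const_le_E {f : Ω → ℝ} (hf : f ∈ S.H) {c : ℝ} (h : ∀ ω, c ≤ f ω) : c ≤ S.E f :=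
  S.const c ▸ S.mono _ hf _ (const_mem c) h

theorem E_eq_expect {f : Ω → ℝ} (hf : f ∈ S.Hb) : S.E f = S.expect f := by
  obtain ⟨hf, M, hM⟩ := hf
  refine (EReal.coe_toReal ?_ ?_).symm
  · exact ((E_le_const hf fun ω => (abs_le.1 (hM ω)).2).trans_lt (EReal.coe_lt_top M)).ne
  · exact ((EReal.bot_lt_coe (-M)).trans_le (const_le_E hf fun ω => (abs_le.1 (hM ω)).1)).ne'

theorem expect_const (c : ℝ) : S.expect (fun _ => c) = c := by
  rw [expect, S.const, EReal.toReal_coe]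

theorem expect_mono {f g : Ω → ℝ} (hf : f ∈ S.Hb) (hg : g ∈ S.Hb) (h : ∀ ω, f ω ≤ g ω) :
    S.expect f ≤ S.expect g := by
  have := S.mono g hg.1 f hf.1 h
  rwa [E_eq_expect hf, E_eq_expect hg, EReal.coe_le_coe_iff] at this

theorem expect_add_le {f g : Ω → ℝ} (hf : f ∈ S.Hb) (hg : g ∈ S.Hb) :
    S.expect (f + g) ≤ S.expect f + S.expect g := by
  have := S.subadd f hf.1 g hg.1 (by simp [E_eq_expect hf]) (by simp [E_eq_expect hf])
  rwa [E_eq_expect hf, E_eq_expect hg, E_eq_expect (Hb.add hf hg), ← EReal.coe_add,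
    EReal.coe_le_coe_iff] at this

theorem expect_smul {f : Ω → ℝ} (hf : f ∈ S.Hb) {a : ℝ} (ha : 0 ≤ a) :
    S.expect (a • f) = a * S.expect f := by
  have := S.pos_homog f hf.1 a ha
  rwa [E_eq_expect hf, E_eq_expect (Hb.smul hf a), ← EReal.coe_mul, EReal.coe_eq_coe_iff] at this

theorem expect_le_const {f : Ω → ℝ} (hf : f ∈ S.Hb) {c : ℝ} (h : ∀ ω, f ω ≤ c) :
    S.expect f ≤ c := expect_const (S := S) c ▸ expect_mono hf (Hb.const c) h

theorem const_le_expect {f : Ω → ℝ} (hf : f ∈ S.Hb) {c : ℝ} (h : ∀ ω, c ≤ f ω) :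
    c ≤ S.expect f := expect_const (S := S) c ▸ expect_mono (Hb.const c) hf h

theorem expect_add_const {f : Ω → ℝ} (hf : f ∈ S.Hb) (c : ℝ) :
    S.expect (fun ω => f ω + c) = S.expect f + c := by
  have h1 := expect_add_le hf (Hb.const c)
  have h2 := expect_add_le (Hb.add hf (Hb.const c)) (Hb.const (-c))
  have h3 : f + (fun _ => c) + (fun _ => -c) = f := by ext; simp
  rw [h3] at h2
  rw [expect_const] at h1 h2
  exact le_antisymm h1 (by linarith : S.expect f + c ≤ S.expect (f + fun _ => c))

theorem expect_le_add_of_abs_sub_le {f g h : Ω → ℝ} (hf : f ∈ S.Hb) (hg : g ∈ S.Hb)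
    (hh : h ∈ S.Hb) (hfg : ∀ ω, |f ω - g ω| ≤ h ω) : S.expect f ≤ S.expect g + S.expect h :=
  (expect_mono hf (Hb.add hg hh) fun ω => by
    have := (abs_le.1 (hfg ω)).2
    simp only [Pi.add_apply]
    linarith).trans (expect_add_le hg hh)

theorem neg_expect_neg_le {f : Ω → ℝ} (hf : f ∈ S.Hb) : -S.expect (-f) ≤ S.expect f := by
  have := expect_add_le hf (Hb.neg hf)
  rw [add_neg_cancel, show (0 : Ω → ℝ) = fun _ => 0 from rfl, expect_const] at this
  linarith

/-! ### The representing family of measures -/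

theorem sigmaH_le : S.sigmaH ≤ ‹MeasurableSpace Ω› :=
  iSup_le fun f => (S.measurable_of_mem f f.2).comap_le

theorem measurable_sigmaH {f : Ω → ℝ} (hf : f ∈ S.H) : Measurable[S.sigmaH] f :=
  Measurable.of_comap_le
    (le_iSup (fun f : S.H => MeasurableSpace.comap (f : Ω → ℝ) (borel ℝ)) ⟨f, hf⟩)

variable {Ps : Set (@Measure Ω S.sigmaH)}

theorem CC.integrable (h : S.CC Ps) {P : @Measure Ω S.sigmaH} (hP : P ∈ Ps) {f : Ω → ℝ}
    (hf : f ∈ S.Hb) : Integrable f P := by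
  have := h.isProb P hP
  obtain ⟨hf, M, hM⟩ := hf
  exact Integrable.of_bound (measurable_sigmaH hf).aestronglyMeasurable M (ae_of_all _ hM)

theorem CC.integral_le (h : S.CC Ps) {P : @Measure Ω S.sigmaH} (hP : P ∈ Ps) {f : Ω → ℝ}
    (hf : f ∈ S.Hb) : ∫ ω, f ω ∂P ≤ S.expect f := by
  have h1 := h.repr f hf
  rw [E_eq_expect hf] at h1
  exact EReal.coe_le_coe_iff.1 (h1 ▸ le_iSup₂ (f := fun (P : @Measure Ω S.sigmaH) (_ : P ∈ Ps) =>
    ((∫ ω, f ω ∂P : ℝ) : EReal)) P hP)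

theorem CC.exists_lt_integral (h : S.CC Ps) {f : Ω → ℝ} (hf : f ∈ S.Hb) {a : ℝ}
    (ha : a < S.expect f) : ∃ P ∈ Ps, a < ∫ ω, f ω ∂P := by
  have h1 := h.repr f hf
  rw [E_eq_expect hf] at h1
  have h2 : (a : EReal) < ⨆ P ∈ Ps, ((∫ ω, f ω ∂P : ℝ) : EReal) := h1 ▸ EReal.coe_lt_coe_iff.2 ha
  simp only [lt_iSup_iff, EReal.coe_lt_coe_iff, exists_prop] at h2
  exact h2

/-- A coordinate function is not bounded, but clamping the last coordinate at a bound of `Y i` gives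
a function in `C_{b,Lip}` that returns `Y i` itself. -/
theorem CC.exists_subseq (h : S.CC Ps) {Y : ℕ → Ω → ℝ} (hY : ∀ i, Y i ∈ S.Hb)
    {Q : ℕ → @Measure Ω S.sigmaH} (hQ : ∀ n, Q n ∈ Ps) :
    ∃ k : ℕ → ℕ, StrictMono k ∧ ∃ P ∈ Ps, ∀ i,
      Tendsto (fun j => ∫ ω, Y i ω ∂(Q (k j))) atTop (𝓝 (∫ ω, Y i ω ∂P)) := by
  obtain ⟨k, hk, P, hP, hlim⟩ := h.compact Y hY Q hQ
  refine ⟨k, hk, P, hP, fun i => ?_⟩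
  obtain ⟨M, hM⟩ := (hY i).2
  have := hlim (i + 1) (by omega) _ (CBLip.clamp_coord (Fin.last i) (abs_nonneg M))
  simpa [clamp_of_abs_le ((hM _).trans (le_abs_self M))] using this

/-- Continuity from above on `ℋ_b`, as in Dini's theorem. Otherwise some `Q i ∈ Ps` has `∫ Y i > δ`
for each `i`. By monotonicity in `i` a limit measure `P` keeps `∫ Y i ≥ δ` for every `i`, which
contradicts dominated convergence. -/
theorem CC.exists_expect_le (h : S.CC Ps) {Y : ℕ → Ω → ℝ} (hY : ∀ i, Y i ∈ S.Hb)
    (hanti : ∀ ω, Antitone fun i => Y i ω) (hlim : ∀ ω, Tendsto (fun i => Y i ω) atTop (𝓝 0))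
    {δ : ℝ} (hδ : 0 < δ) : ∃ i, S.expect (Y i) ≤ δ := by
  by_contra! hcon
  choose Q hQ hQδ using fun i => h.exists_lt_integral (hY i) (hcon i)
  obtain ⟨k, hk, P, hP, hconv⟩ := h.exists_subseq hY hQ
  have hge : ∀ i, δ ≤ ∫ ω, Y i ω ∂P := fun i => by
    refine ge_of_tendsto (hconv i) ?_
    filter_upwards [eventually_ge_atTop i] with j hj
    exact (hQδ _).le.trans (integral_mono (h.integrable (hQ _) (hY _)) (h.integrable (hQ _) (hY _))
      fun ω => hanti ω (hj.trans (hk.id_le j)))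
  obtain ⟨M, hM⟩ := (hY 0).2
  have := h.isProb P hP
  have h0 : ∀ i ω, 0 ≤ Y i ω := fun i ω => (hanti ω).le_of_tendsto (hlim ω) i
  have hdct : Tendsto (fun i => ∫ ω, Y i ω ∂P) atTop (𝓝 (∫ _, (0 : ℝ) ∂P)) :=
    tendsto_integral_of_dominated_convergence (fun _ => M)
      (fun i => (h.integrable hP (hY i)).aestronglyMeasurable) (integrable_const M)
      (fun i => ae_of_all _ fun ω => by
        rw [Real.norm_of_nonneg (h0 i ω)]
        exact (hanti ω (Nat.zero_le i)).trans ((le_abs_self _).trans (hM ω)))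
      (ae_of_all _ hlim)
  rw [integral_zero] at hdct
  exact hδ.not_ge (ge_of_tendsto' hdct hge)

/-- The representation of `𝔼` by `Ps` covers bounded functions only; truncation and monotone
convergence carry this one inequality over to unbounded `f ≥ 0`. -/
theorem CC.lintegral_le (h : S.CC Ps) {P : @Measure Ω S.sigmaH} (hP : P ∈ Ps) {f : Ω → ℝ}
    (hf : f ∈ S.H) (h0 : ∀ ω, 0 ≤ f ω) :
    ∫⁻ ω, ENNReal.ofReal (f ω) ∂P ≤ (S.E f).toENNReal := by
  have hm := measurable_sigmaH hf
  have hsup : ∀ ω, ENNReal.ofReal (f ω) = ⨆ n : ℕ, ENNReal.ofReal (clamp n (f ω)) := fun ω => by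
    refine le_antisymm ?_ (iSup_le fun n => ENNReal.ofReal_le_ofReal
      (max_le ((neg_nonpos.2 n.cast_nonneg).trans (h0 ω)) (min_le_right _ _)))
    obtain ⟨n, hn⟩ := exists_nat_ge (f ω)
    refine le_iSup_of_le n (le_of_eq ?_)
    rw [clamp_of_abs_le (by rwa [abs_of_nonneg (h0 ω)])]
  simp_rw [hsup]
  have hmono : Monotone fun (n : ℕ) ω => ENNReal.ofReal (clamp n (f ω)) := fun n k hnk ω => by
    have hnk' : (n : ℝ) ≤ k := by exact_mod_cast hnk
    refine ENNReal.ofReal_le_ofReal (max_le ?_ ?_)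
    · exact (neg_nonpos.2 n.cast_nonneg).trans
        ((le_min k.cast_nonneg (h0 ω)).trans (le_max_right _ _))
    · exact (min_le_min_right _ hnk').trans (le_max_right _ _)
  have hb : ∀ n : ℕ, (fun ω => clamp n (f ω)) ∈ S.Hb := fun n => Hb.clamp hf n.cast_nonneg
  rw [lintegral_iSup (fun n => (measurable_sigmaH (hb n).1).ennreal_ofReal) hmono]
  refine iSup_le fun n => ?_
  rw [← ofReal_integral_eq_lintegral_ofReal (h.integrable hP (hb n)) (ae_of_all _ fun ω =>
    (le_min n.cast_nonneg (h0 ω)).trans (le_max_right _ _))]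
  refine EReal.toENNReal_le_toENNReal (x := ((∫ ω, clamp n (f ω) ∂P : ℝ) : EReal)) ?_
  refine (EReal.coe_le_coe_iff.2 (h.integral_le hP (hb n))).trans ?_
  rw [← E_eq_expect (hb n)]
  exact S.mono _ hf _ (hb n).1 fun ω =>
    max_le ((neg_nonpos.2 n.cast_nonneg).trans (h0 ω)) (min_le_right _ _)

end SubLinExpSpace

namespace SubLinExpSpace

variable {Ω : Type*} [MeasurableSpace Ω] {S : SubLinExpSpace Ω}
  {Ps : Set (@Measure Ω S.sigmaH)}

/-! ### Comparison of the capacities -/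

/-- Here `f` is bounded above only. Its positive part lies in `ℋ_b`, dominates `f` and has the same
`ENNReal.ofReal`. -/
theorem CC.E_le_of_lintegral_le (h : S.CC Ps) {f : Ω → ℝ} (hf : f ∈ S.H) (h1 : ∀ ω, f ω ≤ 1)
    {c : ℝ≥0∞} (hc : ∀ P ∈ Ps, ∫⁻ ω, ENNReal.ofReal (f ω) ∂P ≤ c) : S.E f ≤ c := by
  have hp : ∀ s t : ℝ, |max s 0 - max t 0| ≤ |s - t| := fun s t => abs_max_sub_max_le_abs s t 0
  have hb : (fun ω => max (f ω) 0) ∈ S.Hb := ⟨comp_lipschitz_mem hf _ hp, 1, fun ω => by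
    rw [abs_of_nonneg (le_max_right _ _)]
    exact max_le (h1 ω) zero_le_one⟩
  refine (S.mono _ hb.1 _ hf fun ω => le_max_left _ _).trans ?_
  rw [h.repr _ hb]
  refine iSup₂_le fun P hP => ?_
  have h2 := hc P hP
  have h3 : ∀ ω, ENNReal.ofReal (f ω) = ENNReal.ofReal (max (f ω) 0) := fun ω => by
    rw [ENNReal.ofReal_max, ENNReal.ofReal_zero, max_eq_left zero_le]
  rw [lintegral_congr h3, ← ofReal_integral_eq_lintegral_ofReal (h.integrable hP hb)
    (ae_of_all _ fun ω => le_max_right _ _), ← EReal.coe_ennreal_le_coe_ennreal_iff,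
    EReal.coe_ennreal_ofReal] at h2
  exact (EReal.coe_le_coe_iff.2 (le_max_left _ _)).trans h2

theorem CC.lintegral_le_of_le_tsum (h : S.CC Ps) {P : @Measure Ω S.sigmaH} (hP : P ∈ Ps)
    {f : Ω → ℝ≥0∞} {g : ℕ → Ω → ℝ} (hg : ∀ n, g n ∈ S.H ∧ ∀ ω, 0 ≤ g n ω)
    (hfg : ∀ ω, f ω ≤ ∑' n, ENNReal.ofReal (g n ω)) :
    ∫⁻ ω, f ω ∂P ≤ ⨆ n : ℕ, (S.E (∑ i ∈ Finset.range n, g i)).toENNReal := by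
  refine (lintegral_mono hfg).trans ?_
  simp_rw [ENNReal.tsum_eq_iSup_nat]
  rw [lintegral_iSup (fun n => Finset.measurable_sum _ fun i _ =>
    (measurable_sigmaH (hg i).1).ennreal_ofReal) fun n k hnk ω =>
      Finset.sum_le_sum_of_subset (Finset.range_mono hnk)]
  refine iSup_mono fun n => ?_
  refine le_trans (le_of_eq ?_) (h.lintegral_le hP (S.H.sum_mem fun i _ => (hg i).1)
    fun ω => by rw [Finset.sum_apply]; exact Finset.sum_nonneg fun i _ => (hg i).2 ω)
  refine lintegral_congr fun ω => ?_
  rw [Finset.sum_apply, ENNReal.ofReal_sum_of_nonneg fun i _ => (hg i).2 ω]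

theorem ofReal_le_indicator {α : Type*} {A : Set α} {f : α → ℝ}
    (h : ∀ ω, f ω ≤ A.indicator (fun _ => (1 : ℝ)) ω) (ω : α) :
    ENNReal.ofReal (f ω) ≤ A.indicator (fun _ => (1 : ℝ≥0∞)) ω := by
  have := ENNReal.ofReal_le_ofReal (h ω)
  by_cases hω : ω ∈ A <;> simpa [hω] using this

theorem le_one_of_le_indicator {α : Type*} {A : Set α} {f : α → ℝ}
    (h : ∀ ω, f ω ≤ A.indicator (fun _ => (1 : ℝ)) ω) (ω : α) : f ω ≤ 1 :=
  (h ω).trans (Set.indicator_le_self' (fun _ _ => zero_le_one) ω)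

theorem IndLE.nonneg {α : Type*} {A : Set α} {g : α → ℝ} (h : IndLE A g) (ω : α) : 0 ≤ g ω :=
  (Set.indicator_nonneg (fun _ _ => zero_le_one) ω).trans (h ω)

theorem CC.E_le_capP (h : S.CC Ps) {A : Set Ω} (hA : MeasurableSet[S.sigmaH] A) {f : Ω → ℝ}
    (hf : f ∈ S.H) (hfA : ∀ ω, f ω ≤ A.indicator (fun _ => (1 : ℝ)) ω) :
    S.E f ≤ (S.capP Ps A : EReal) := by
  refine h.E_le_of_lintegral_le hf (le_one_of_le_indicator hfA) fun P hP => ?_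
  calc ∫⁻ ω, ENNReal.ofReal (f ω) ∂P ≤ ∫⁻ ω, A.indicator (fun _ => (1 : ℝ≥0∞)) ω ∂P :=
        lintegral_mono (ofReal_le_indicator hfA)
    _ = P A := by rw [lintegral_indicator hA, setLIntegral_one]
    _ ≤ S.capP Ps A := le_iSup₂ (f := fun (P : @Measure Ω S.sigmaH) (_ : P ∈ Ps) => P A) P hP

theorem CC.E_le_capC (h : S.CC Ps) {A : Set Ω} {f : Ω → ℝ}
    (hf : f ∈ S.H) (hfA : ∀ ω, f ω ≤ A.indicator (fun _ => (1 : ℝ)) ω) :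
    S.E f ≤ (S.capC A : EReal) :=
  h.E_le_of_lintegral_le hf (le_one_of_le_indicator hfA) fun _ hP =>
    le_iInf fun _ => le_iInf fun hg => le_iInf fun hAg =>
      h.lintegral_le_of_le_tsum hP hg fun ω => (ofReal_le_indicator hfA ω).trans (hAg ω)

theorem CC.capP_le_capC (h : S.CC Ps) {A : Set Ω} (hA : MeasurableSet[S.sigmaH] A) :
    S.capP Ps A ≤ S.capC A := by
  refine iSup₂_le fun P hP => le_iInf fun g => le_iInf fun hg => le_iInf fun hAg => ?_
  refine le_trans (le_of_eq ?_) (h.lintegral_le_of_le_tsum hP hg hAg)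
  rw [lintegral_indicator hA, setLIntegral_one]

theorem toENNReal_E_sum_le {g : ℕ → Ω → ℝ} (hg : ∀ n, g n ∈ S.H ∧ ∀ ω, 0 ≤ g n ω) (n : ℕ) :
    (S.E (∑ i ∈ Finset.range n, g i)).toENNReal ≤
      ∑ i ∈ Finset.range n, (S.E (g i)).toENNReal := by
  induction n with
  | zero => simp [show S.E 0 = 0 from S.const 0]
  | succ n ih =>
    have h1 : ∑ i ∈ Finset.range n, g i ∈ S.H := S.H.sum_mem fun i _ => (hg i).1
    have h2 : ∀ ω, 0 ≤ (∑ i ∈ Finset.range n, g i) ω := fun ω => by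
      rw [Finset.sum_apply]; exact Finset.sum_nonneg fun i _ => (hg i).2 ω
    rw [Finset.sum_range_succ, Finset.sum_range_succ]
    refine (EReal.toENNReal_le_toENNReal (S.subadd _ h1 _ (hg n).1
      (fun hh => E_ne_bot (hg n).1 (hg n).2 hh.2) fun hh => E_ne_bot h1 h2 hh.1)).trans ?_
    rw [EReal.toENNReal_add (E_nonneg h1 h2) (E_nonneg (hg n).1 (hg n).2)]
    gcongr

theorem capHat_le {A : Set Ω} {g : Ω → ℝ} (hg : g ∈ S.H) (hA : IndLE A g) :
    S.capHat A ≤ (S.E g).toENNReal :=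
  iInf_le_of_le g (iInf_le_of_le hg (iInf_le _ hA))

theorem capHat_le_one (A : Set Ω) : S.capHat A ≤ 1 :=
  (capHat_le (const_mem 1) (Set.indicator_le_self' fun _ _ => zero_le_one)).trans
    (by rw [S.const, EReal.real_coe_toENNReal, ENNReal.ofReal_one])

theorem capHat_empty : S.capHat ∅ = 0 :=
  le_antisymm ((capHat_le (const_mem 0) fun ω => by simp).trans (by rw [S.const]; simp)) zero_le

theorem capHatStar_le_capHat {A : Set Ω} (hA : MeasurableSet A) :
    S.capHatStar A ≤ S.capHat A := by
  refine iInf_le_of_le (fun n => if n = 0 then A else ∅) (iInf_le_of_le (fun n => ?_)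
    (iInf_le_of_le (Set.subset_iUnion_of_subset 0 (by simp)) ?_))
  · dsimp only
    split_ifs
    exacts [hA, MeasurableSet.empty]
  · rw [tsum_eq_single 0 fun n hn => by simp [hn, capHat_empty]]
    simp

/-- Near-optimal `ξₙ ≥ I_{Bₙ}` for the sets of a cover form an admissible series for `capC`, and
sub-additivity bounds its partial sums. The errors `δₙ` sum to less than `ε`. -/
theorem capC_le_capHatStar (A : Set Ω) : S.capC A ≤ S.capHatStar A := by
  refine le_iInf fun B => le_iInf fun _ => le_iInf fun hAB => ?_
  refine ENNReal.le_of_forall_pos_le_add fun ε hε _ => ?_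
  obtain ⟨δ, hδ, hsum⟩ := ENNReal.exists_pos_sum_of_countable
    (ENNReal.coe_pos.2 hε).ne' ℕ
  have hex : ∀ n, ∃ ξ ∈ S.H, IndLE (B n) ξ ∧ (S.E ξ).toENNReal < S.capHat (B n) + δ n := fun n => by
    have : S.capHat (B n) < S.capHat (B n) + δ n :=
      -- The strict inequality needs `capHat` finite, which holds since it is at most `1`.
      ENNReal.lt_add_right ((capHat_le_one _).trans_lt ENNReal.one_lt_top).ne
        (ENNReal.coe_pos.2 (hδ n)).ne'
    conv_lhs at this => rw [capHat]
    simpa only [iInf_lt_iff, exists_prop] using this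
  choose ξ hξ hB hlt using hex
  have hg : ∀ n, ξ n ∈ S.H ∧ ∀ ω, 0 ≤ ξ n ω := fun n => ⟨hξ n, (hB n).nonneg⟩
  refine iInf_le_of_le ξ (iInf_le_of_le hg (iInf_le_of_le (fun ω => ?_) (iSup_le fun n => ?_)))
  · by_cases hω : ω ∈ A
    · obtain ⟨n, hn⟩ := Set.mem_iUnion.1 (hAB hω)
      rw [Set.indicator_of_mem hω]
      refine le_trans ?_ (ENNReal.le_tsum n)
      have := hB n ω
      rw [Set.indicator_of_mem hn] at this
      exact ENNReal.one_le_ofReal.2 this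
    · simp [hω]
  · calc _ ≤ ∑ i ∈ Finset.range n, (S.E (ξ i)).toENNReal := toENNReal_E_sum_le hg n
      _ ≤ ∑' i, (S.E (ξ i)).toENNReal := ENNReal.sum_le_tsum _
      _ ≤ ∑' i, (S.capHat (B i) + δ i) := ENNReal.tsum_le_tsum fun i => (hlt i).le
      _ = ∑' i, S.capHat (B i) + ∑' i, (δ i : ℝ≥0∞) := ENNReal.tsum_add
      _ ≤ _ := by gcongr

theorem coe_le_E_of_le_capHat {A : Set Ω} {g : Ω → ℝ} (hg : g ∈ S.H) (hA : IndLE A g) {c : ℝ≥0∞}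
    (hc : c ≤ S.capHat A) : (c : EReal) ≤ S.E g := by
  rw [← EReal.coe_toENNReal (E_nonneg hg hA.nonneg)]
  exact EReal.coe_ennreal_le_coe_ennreal_iff.2 (hc.trans (capHat_le hg hA))

theorem CC.brackets_capP (h : S.CC Ps) : S.Brackets {A | MeasurableSet[S.sigmaH] A} (S.capP Ps) :=
  fun A hA _ hf _ hg hfA hAg => ⟨h.E_le_capP hA hf hfA, coe_le_E_of_le_capHat hg hAg
    ((h.capP_le_capC hA).trans ((capC_le_capHatStar A).trans
      (capHatStar_le_capHat (sigmaH_le A hA))))⟩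

theorem CC.brackets_of_le (h : S.CC Ps) {V : Set Ω → ℝ≥0∞}
    (hV : ∀ A, MeasurableSet A → S.capC A ≤ V A ∧ V A ≤ S.capHat A) :
    S.Brackets {A | MeasurableSet A} V :=
  fun A hA _ hf _ hg hfA hAg => ⟨(h.E_le_capC hf hfA).trans
    (EReal.coe_ennreal_le_coe_ennreal_iff.2 (hV A hA).1), coe_le_E_of_le_capHat hg hAg (hV A hA).2⟩

end SubLinExpSpace

theorem CBLip.abs {V : Type*} [NormedAddCommGroup V] {φ : V → ℝ} (h : CBLip φ) :
    CBLip (fun x => |φ x|) := by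
  obtain ⟨⟨K, hK⟩, M, hM⟩ := h
  exact ⟨⟨K, fun x y => (abs_abs_sub_abs_le _ _).trans (hK x y)⟩, M, fun x => by
    rw [abs_abs]; exact hM x⟩

namespace SubLinExpSpace

section Cylinders

variable {Ω : Type*} {X : ℕ → Ω → ℝ}

/-! ### Bounded Lipschitz functions of the first variables -/

/-- The bounded Lipschitz functions of `X 0, …, X (n - 1)`. -/
def cylinders (X : ℕ → Ω → ℝ) (n : ℕ) : Set (Ω → ℝ) :=
  {Y | ∃ φ : (Fin n → ℝ) → ℝ, CBLip φ ∧ Y = fun ω => φ fun i => X i ω}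

theorem cylinders_const {n : ℕ} (c : ℝ) : (fun _ => c) ∈ cylinders X n :=
  ⟨_, CBLip.const c, rfl⟩

theorem cylinders_add {n : ℕ} {f g : Ω → ℝ} (hf : f ∈ cylinders X n) (hg : g ∈ cylinders X n) :
    (fun ω => f ω + g ω) ∈ cylinders X n := by
  obtain ⟨φ, hφ, rfl⟩ := hf
  obtain ⟨ψ, hψ, rfl⟩ := hg
  exact ⟨_, hφ.add hψ, rfl⟩

theorem cylinders_mul {n : ℕ} {f g : Ω → ℝ} (hf : f ∈ cylinders X n) (hg : g ∈ cylinders X n) :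
    (fun ω => f ω * g ω) ∈ cylinders X n := by
  obtain ⟨φ, hφ, rfl⟩ := hf
  obtain ⟨ψ, hψ, rfl⟩ := hg
  exact ⟨_, hφ.mul hψ, rfl⟩

theorem cylinders_neg {n : ℕ} {f : Ω → ℝ} (hf : f ∈ cylinders X n) :
    (fun ω => -f ω) ∈ cylinders X n := by
  obtain ⟨φ, hφ, rfl⟩ := hf
  exact ⟨_, hφ.neg, rfl⟩

theorem cylinders_sum {n : ℕ} {ι : Type*} {s : Finset ι} {f : ι → Ω → ℝ}
    (hf : ∀ i ∈ s, f i ∈ cylinders X n) : (fun ω => ∑ i ∈ s, f i ω) ∈ cylinders X n := by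
  classical
  induction s using Finset.induction_on with
  | empty => simpa using cylinders_const 0
  | insert a s ha ih =>
    simp_rw [Finset.sum_insert ha]
    exact cylinders_add (hf a (Finset.mem_insert_self a s))
      (ih fun i hi => hf i (Finset.mem_insert_of_mem hi))

theorem cylinders_mono : Monotone (cylinders X) := by
  rintro n k hnk _ ⟨φ, hφ, rfl⟩
  refine ⟨fun x => φ fun i => x (Fin.castLE hnk i), hφ.comp _ fun x y => ?_, rfl⟩
  exact (pi_norm_le_iff_of_nonneg (norm_nonneg _)).2 fun i => norm_le_pi_norm (x - y) _

theorem comp_mem_cylinders {f : (Fin 1 → ℝ) → ℝ} (hf : CBLip f) (n : ℕ) :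
    (fun ω => f fun _ => X n ω) ∈ cylinders X (n + 1) := by
  refine ⟨fun x => f fun _ => x (Fin.last n), hf.comp _ fun x y => ?_, rfl⟩
  exact (pi_norm_le_iff_of_nonneg (norm_nonneg _)).2 fun i => norm_le_pi_norm (x - y) _

end Cylinders

variable {Ω : Type*} [MeasurableSpace Ω] {S : SubLinExpSpace Ω}
  {Ps : Set (@Measure Ω S.sigmaH)} {X : ℕ → Ω → ℝ}

theorem comp_mem_Hb {n : ℕ} {Z : Fin n → Ω → ℝ} (hZ : ∀ i, Z i ∈ S.H) {φ : (Fin n → ℝ) → ℝ}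
    (hφ : CBLip φ) : (fun ω => φ fun i => Z i ω) ∈ S.Hb := by
  obtain ⟨M, hM⟩ := hφ.2
  exact ⟨S.comp_mem n Z hZ φ hφ.toCLLip, M, fun ω => hM _⟩

theorem cylinders_subset_Hb (hX : ∀ n, X n ∈ S.H) {n : ℕ} : cylinders X n ⊆ S.Hb := by
  rintro _ ⟨φ, hφ, rfl⟩
  exact comp_mem_Hb (fun i => hX i) hφ

/-! ### Consequences of independence -/

/-- This is what makes the independence hypothesis usable: the inner expectation is again bounded
Lipschitz, so its composition with `X` lies in `ℋ_b` and all side conditions of `IndepTo` hold. -/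
theorem _root_.CBLip.expect {W : Type*} [NormedAddCommGroup W] {Z : Ω → ℝ} (hZ : Z ∈ S.H)
    {φ : W × (Fin 1 → ℝ) → ℝ} (hφ : CBLip φ) :
    CBLip (fun x => S.expect fun ω => φ (x, fun _ => Z ω)) := by
  obtain ⟨K, M, hK0, hM0, hK, hM⟩ := hφ.exists_nonneg
  have hb : ∀ x, (fun ω => φ (x, fun _ => Z ω)) ∈ S.Hb := fun x =>
    comp_mem_Hb (Z := fun _ : Fin 1 => Z) (fun _ => hZ) (hφ.comp (fun y => (x, y)) fun y z => by
      simp [Prod.norm_def])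
  have hle : ∀ x y, (S.expect fun ω => φ (x, fun _ => Z ω)) ≤
      (S.expect fun ω => φ (y, fun _ => Z ω)) + K * ‖x - y‖ := fun x y => by
    refine (expect_le_add_of_abs_sub_le (hb x) (hb y) (Hb.const (K * ‖x - y‖)) fun ω => ?_).trans
      (by rw [expect_const])
    refine (hK _ _).trans (le_of_eq ?_)
    simp [Prod.norm_def]
  refine ⟨⟨K, fun x y => abs_sub_le_iff.2 ⟨?_, ?_⟩⟩, M, fun x => abs_le.2 ⟨?_, ?_⟩⟩
  · linarith [hle x y]
  · have := hle y x
    rw [norm_sub_rev] at this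
    linarith
  · exact const_le_expect (hb x) fun ω => (abs_le.1 (hM _)).1
  · exact expect_le_const (hb x) fun ω => (abs_le.1 (hM _)).2

theorem IsIID.expect_comp_eq (hX : S.IsIID X) {f : (Fin 1 → ℝ) → ℝ} (hf : CBLip f) (n : ℕ) :
    (S.expect fun ω => f fun _ => X n ω) = S.expect fun ω => f fun _ => X 0 ω :=
  congrArg EReal.toReal (hX.ident n f hf)

theorem IsIID.expect_prod (hX : S.IsIID X) {n : ℕ} {φ : (Fin n → ℝ) × (Fin 1 → ℝ) → ℝ}
    (hφ : CBLip φ) :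
    (S.expect fun ω => φ (fun i => X i ω, fun _ => X n ω)) =
      S.expect fun ω => S.expect fun ω' => φ (fun i => X i ω, fun _ => X 0 ω') := by
  cases n with
  | zero =>
    -- `IndepTo` says nothing about an empty past; here the section is constant and the claim is
    -- trivial.
    have : ∀ ω, (fun i : Fin 0 => X i ω) = fun i => i.elim0 := fun ω => Subsingleton.elim _ _
    simp_rw [this]
    rw [expect_const]
  | succ n =>
    have hsec : ∀ x, CBLip fun y => φ (x, y) := fun x => hφ.comp _ fun y z => by
      simp [Prod.norm_def]
    have hb : ∀ x, (fun ω => φ (x, fun _ => X (n + 1) ω)) ∈ S.Hb := fun x =>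
      comp_mem_Hb (Z := fun _ : Fin 1 => X (n + 1)) (fun _ => hX.mem _) (hsec x)
    have hb' : ∀ x, (fun ω => |φ (x, fun _ => X (n + 1) ω)|) ∈ S.Hb := fun x =>
      comp_mem_Hb (Z := fun _ : Fin 1 => X (n + 1)) (fun _ => hX.mem _) (hsec x).abs
    have h1 := comp_mem_Hb (S := S) (Z := fun i : Fin (n + 1) => X i) (fun i => hX.mem i)
      (hφ.abs.expect (hX.mem (n + 1))).abs
    have h2 := comp_mem_Hb (S := S) (Z := fun i : Fin (n + 1) => X i) (fun i => hX.mem i)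
      (hφ.expect (hX.mem (n + 1)))
    have := hX.indep n φ hφ.toCLLip
      (fun x => by rw [E_eq_expect (hb' x)]; exact EReal.coe_lt_top _) h1.1
      (by
        have h3 := E_eq_expect h1
        exact h3.trans_lt (EReal.coe_lt_top _)) h2.1
    refine (congrArg EReal.toReal this).trans ?_
    -- Identical distribution replaces `X (n + 1)` by `X 0` in the inner expectation.
    have h4 : ∀ ω, (S.E fun ω' => φ (fun i => X i ω, fun _ => X (n + 1) ω')).toReal =
        S.expect fun ω' => φ (fun i => X i ω, fun _ => X 0 ω') := fun ω =>
      hX.expect_comp_eq (hsec _) (n + 1)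
    simp_rw [h4]
    rfl

/-! ### Lower bounds for expectations of negative squares. -/

theorem expect_smul_nonneg {Z : Ω → ℝ} (hZ : Z ∈ S.Hb) (h1 : 0 ≤ S.expect Z)
    (h2 : 0 ≤ S.expect (-Z)) (a : ℝ) : 0 ≤ S.expect (a • Z) := by
  rcases le_total 0 a with ha | ha
  · rw [expect_smul hZ ha]
    exact mul_nonneg ha h1
  · rw [← neg_smul_neg, expect_smul (Hb.neg hZ) (neg_nonneg.2 ha)]
    exact mul_nonneg (neg_nonneg.2 ha) h2

/-- In the expanded square the linear term `-2ctZ` has nonnegative expectation whatever the sign of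
`t`, and `Z² ≤ M²`. -/
theorem le_expect_sub_sq {Z : Ω → ℝ} (hZ : Z ∈ S.Hb) (h1 : 0 ≤ S.expect Z)
    (h2 : 0 ≤ S.expect (-Z)) {M : ℝ} (hM : ∀ ω, |Z ω| ≤ M) {c : ℝ} (hc : 0 ≤ c) (a t : ℝ)
    (hb : (fun ω => a - c * (t + Z ω) ^ 2) ∈ S.Hb) :
    a - c * t ^ 2 - c * M ^ 2 ≤ S.expect fun ω => a - c * (t + Z ω) ^ 2 := by
  have h3 := expect_smul_nonneg hZ h1 h2 (-(2 * c * t))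
  have h4 := Hb.smul hZ (-(2 * c * t))
  have h5 := expect_add_const h4 (a - c * t ^ 2 - c * M ^ 2)
  have h6 : S.expect (fun ω => (-(2 * c * t) • Z) ω + (a - c * t ^ 2 - c * M ^ 2)) ≤
      S.expect fun ω => a - c * (t + Z ω) ^ 2 := by
    refine expect_mono (Hb.add h4 (Hb.const _)) hb fun ω => ?_
    have h7 : Z ω ^ 2 ≤ M ^ 2 := sq_le_sq' (abs_le.1 (hM ω)).1 (abs_le.1 (hM ω)).2
    have h8 := mul_le_mul_of_nonneg_left h7 hc
    simp only [Pi.smul_apply, smul_eq_mul]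
    linarith [h8]
  linarith

variable (X) in
/-- The centred sums `∑_{i < n} (f (Xᵢ) - m)`. -/
def centredSum (f : (Fin 1 → ℝ) → ℝ) (m : ℝ) (n : ℕ) (ω : Ω) : ℝ :=
  ∑ i ∈ Finset.range n, ((f fun _ => X i ω) - m)

theorem centredSum_mem {Ω : Type*} {X : ℕ → Ω → ℝ} {f : (Fin 1 → ℝ) → ℝ} (hf : CBLip f) (m : ℝ) {j n : ℕ} (hj : j ≤ n) :
    centredSum X f m j ∈ cylinders X n :=
  cylinders_mono hj (cylinders_sum fun i hi => cylinders_mono (Finset.mem_range.1 hi)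
    (cylinders_add (comp_mem_cylinders hf i) (cylinders_const (-m))))

/-- The bound `d ≤ n + 1` is sharp for the recursion: the sums of index `j ≤ n` involve only `X 0,
…, X (n - 1)`. -/
theorem sum_sq_mem {Ω : Type*} {X : ℕ → Ω → ℝ} {f : (Fin 1 → ℝ) → ℝ} (hf : CBLip f) (m : ℝ) (c : ℕ → ℝ) {d n : ℕ}
    (hd : d ≤ n + 1) :
    (fun ω => ∑ j ∈ Finset.range d, c j * centredSum X f m j ω ^ 2) ∈ cylinders X n := by
  refine cylinders_sum fun j hj => cylinders_mul (cylinders_const (c j)) ?_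
  have := Finset.mem_range.1 hj
  have h := centredSum_mem (X := X) hf m (show j ≤ n by omega)
  simpa only [sq] using cylinders_mul h h

/-- Integrating out the last variable by independence costs at most `c * M ^ 2`: conditionally on
the past, `le_expect_sub_sq` applies to the increment. -/
theorem IsIID.expect_sub_sq_step (hX : S.IsIID X) {f : (Fin 1 → ℝ) → ℝ} (hf : CBLip f) {m M : ℝ}
    (hu : m ≤ S.expect fun ω => f fun _ => X 0 ω)
    (hl : -(S.expect fun ω => -f fun _ => X 0 ω) ≤ m) (hM : ∀ x, |f x - m| ≤ M)
    {c : ℝ} (hc : 0 ≤ c) {n : ℕ} {G s : Ω → ℝ} (hG : G ∈ cylinders X n) (hs : s ∈ cylinders X n) :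
    (S.expect fun ω => G ω - c * s ω ^ 2) - c * M ^ 2 ≤
      S.expect fun ω => G ω - c * (s ω + ((f fun _ => X n ω) - m)) ^ 2 := by
  have hbL : (fun ω => G ω - c * s ω ^ 2) ∈ S.Hb := by
    have := cylinders_add hG (cylinders_neg (cylinders_mul (cylinders_const c) (cylinders_mul hs hs)))
    simpa only [sq, sub_eq_add_neg] using cylinders_subset_Hb hX.mem this
  obtain ⟨γ, hγ, rfl⟩ := hG
  obtain ⟨σ, hσ, rfl⟩ := hs
  have hφ : CBLip fun p : (Fin n → ℝ) × (Fin 1 → ℝ) => γ p.1 - c * (σ p.1 + (f p.2 - m)) ^ 2 := by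
    have h1 : ∀ {ψ : (Fin n → ℝ) → ℝ}, CBLip ψ →
        CBLip fun p : (Fin n → ℝ) × (Fin 1 → ℝ) => ψ p.1 := fun h =>
      h.comp _ fun x y => norm_fst_le (x - y)
    have h2 : CBLip fun p : (Fin n → ℝ) × (Fin 1 → ℝ) => f p.2 := hf.comp _ fun x y =>
      norm_snd_le (x - y)
    have h3 := (h1 hσ).add (h2.add (CBLip.const (-m)))
    simpa only [sq, sub_eq_add_neg] using (h1 hγ).add ((CBLip.const c).mul (h3.mul h3)).neg
  have hfb : (fun ω => f fun _ => X 0 ω) ∈ S.Hb :=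
    comp_mem_Hb (Z := fun _ : Fin 1 => X 0) (fun _ => hX.mem 0) hf
  have hb := comp_mem_Hb (S := S) (Z := fun i : Fin n => X i) (fun i => hX.mem i)
    (hφ.expect (hX.mem 0))
  rw [hX.expect_prod hφ, sub_eq_add_neg, ← expect_add_const hbL]
  refine expect_mono (Hb.add hbL (Hb.const _)) hb fun ω => ?_
  rw [← sub_eq_add_neg]
  refine le_expect_sub_sq (Z := fun ω => (f fun _ => X 0 ω) - m) ?_ ?_ ?_ (fun ω => hM _) hc _ _ ?_
  · simp_rw [sub_eq_add_neg]
    exact Hb.add hfb (Hb.const (-m))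
  · simp_rw [sub_eq_add_neg]
    rw [expect_add_const hfb]
    linarith
  · have : (-fun ω => (f fun _ => X 0 ω) - m) = fun ω => (-(fun ω => f fun _ => X 0 ω)) ω + m := by
      ext ω
      simp only [Pi.neg_apply]
      ring
    rw [this, expect_add_const (Hb.neg hfb)]
    have h0 : (-(fun ω => f fun _ => X 0 ω)) = fun ω => -f fun _ => X 0 ω := rfl
    rw [h0]
    linarith
  · exact comp_mem_Hb (Z := fun _ : Fin 1 => X 0) (fun _ => hX.mem 0)
      (hφ.comp (fun y => (fun i => X i ω, y)) fun y z => by simp [Prod.norm_def])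

/-- The extra square with free weight `a` makes the induction close: removing `X n` turns it into a
multiple of the square of index `n`, which merges with the term of weight `c n`. The induction
hypothesis is then used with `c n + a`. -/
theorem IsIID.le_expect_neg_sum_sq (hX : S.IsIID X) {f : (Fin 1 → ℝ) → ℝ} (hf : CBLip f) {m M : ℝ}
    (hu : m ≤ S.expect fun ω => f fun _ => X 0 ω)
    (hl : -(S.expect fun ω => -f fun _ => X 0 ω) ≤ m) (hM : ∀ x, |f x - m| ≤ M)
    {c : ℕ → ℝ} (hc : ∀ j, 0 ≤ c j) (n : ℕ) : ∀ a : ℝ, 0 ≤ a →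
    -((∑ j ∈ Finset.range n, c j * j) + a * n) * M ^ 2 ≤
      S.expect fun ω => -(∑ j ∈ Finset.range n, c j * centredSum X f m j ω ^ 2)
        - a * centredSum X f m n ω ^ 2 := by
  induction n with
  | zero =>
    intro a _
    simp [centredSum, expect_const]
  | succ n ih =>
    intro a ha
    have h1 := hX.expect_sub_sq_step hf hu hl hM ha (cylinders_neg (sum_sq_mem hf m c le_rfl))
      (centredSum_mem hf m le_rfl) (n := n)
    have h2 := ih (c n + a) (add_nonneg (hc n) ha)
    have h3 : ∀ ω, centredSum X f m (n + 1) ω = centredSum X f m n ω + ((f fun _ => X n ω) - m) :=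
      fun ω => Finset.sum_range_succ _ _
    have h4 : (fun ω => -(∑ j ∈ Finset.range (n + 1), c j * centredSum X f m j ω ^ 2)
        - a * centredSum X f m n ω ^ 2) = fun ω =>
        -(∑ j ∈ Finset.range n, c j * centredSum X f m j ω ^ 2)
        - (c n + a) * centredSum X f m n ω ^ 2 := by
      ext ω
      rw [Finset.sum_range_succ]
      ring
    rw [h4] at h1
    simp_rw [h3]
    refine le_trans ?_ h1
    rw [Finset.sum_range_succ]
    push_cast
    linarith

end SubLinExpSpace

namespace SubLinExpSpace

variable {Ω : Type*} [MeasurableSpace Ω] {S : SubLinExpSpace Ω}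
  {Ps : Set (@Measure Ω S.sigmaH)} {X : ℕ → Ω → ℝ}

/-! ### Disjoint events of full capacity -/

/-- A series of weighted squares of the sums `∑_{i < n} (f (Xᵢ) - m)`. It converges for at most one
value of `m`. -/
noncomputable def squareSeries (X : ℕ → Ω → ℝ) (f : (Fin 1 → ℝ) → ℝ) (m : ℝ) (ω : Ω) : ℝ≥0∞ :=
  ∑' j : ℕ, ENNReal.ofReal (1 / (j : ℝ) ^ 3 * centredSum X f m j ω ^ 2)

/-- The difference of the two sums is `j * (m' - m)`. By `(a - b)² ≤ 2(a² + b²)`, convergence of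
both series would make the harmonic series converge unless `m = m'`. -/
theorem eq_of_squareSeries_ne_top {Ω : Type*} {X : ℕ → Ω → ℝ} {f : (Fin 1 → ℝ) → ℝ} {m m' : ℝ}
    {ω : Ω} (h : squareSeries X f m ω ≠ ⊤) (h' : squareSeries X f m' ω ≠ ⊤) : m = m' := by
  by_contra hne
  have hs : ∀ {p : ℝ}, squareSeries X f p ω ≠ ⊤ →
      Summable fun j : ℕ => 1 / (j : ℝ) ^ 3 * centredSum X f p j ω ^ 2 := fun {p} hp => by
    refine (ENNReal.summable_toReal hp).congr fun j => ENNReal.toReal_ofReal (by positivity)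
  have hdiff : ∀ j, centredSum X f m j ω - centredSum X f m' j ω = j * (m' - m) := fun j => by
    simp only [centredSum, Finset.sum_sub_distrib, Finset.sum_const, Finset.card_range,
      nsmul_eq_mul]
    ring
  have h1 : Summable fun j : ℕ => (m' - m) ^ 2 * (1 / (j : ℝ)) := by
    refine Summable.of_nonneg_of_le (fun j => by positivity) (fun j => ?_)
      (((hs h).add (hs h')).mul_left 2)
    rcases Nat.eq_zero_or_pos j with rfl | hj
    · simp
    · have hj' : (0 : ℝ) < j := by exact_mod_cast hj
      have h2 : (m' - m) ^ 2 * (1 / (j : ℝ)) = 1 / (j : ℝ) ^ 3 * (j * (m' - m)) ^ 2 := by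
        field_simp
      rw [h2, ← hdiff, ← mul_add, ← mul_assoc, mul_comm 2, mul_assoc]
      refine mul_le_mul_of_nonneg_left ?_ (by positivity)
      nlinarith [sq_nonneg (centredSum X f m j ω + centredSum X f m' j ω)]
  rw [summable_mul_left_iff (pow_ne_zero 2 (sub_ne_zero.2 (Ne.symm hne)))] at h1
  exact Real.not_summable_one_div_natCast h1

theorem measurable_squareSeries_of_measurable {Ω : Type*} {_ : MeasurableSpace Ω} {X : ℕ → Ω → ℝ}
    (hX : ∀ i, Measurable (X i)) {f : (Fin 1 → ℝ) → ℝ} (hf : CBLip f) (m : ℝ) :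
    Measurable (squareSeries X f m) := by
  have h1 : ∀ i, Measurable fun ω => (f fun _ => X i ω) := fun i =>
    hf.continuous.measurable.comp (measurable_pi_lambda _ fun _ => hX i)
  refine Measurable.tsum fun j => Measurable.ennreal_ofReal ?_
  exact ((Finset.measurable_sum _ fun i _ => (h1 i).sub_const m).pow_const 2).const_mul _

theorem measurable_squareSeries {Ω : Type*} {X : ℕ → Ω → ℝ} {f : (Fin 1 → ℝ) → ℝ} (hf : CBLip f)
    (m : ℝ) : Measurable[sigmaSeq X] (squareSeries X f m) :=
  measurable_squareSeries_of_measurable (fun i => Measurable.of_comap_le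
    (le_iSup (fun i => MeasurableSpace.comap (X i) (borel ℝ)) i)) hf m

theorem sigmaSeq_le_sigmaH (hX : ∀ n, X n ∈ S.H) : sigmaSeq X ≤ S.sigmaH :=
  iSup_le fun n => le_iSup (fun f : S.H => MeasurableSpace.comap (f : Ω → ℝ) (borel ℝ)) ⟨X n, hX n⟩

/-- The lower bound gives, for each partial sum `W d`, a measure with `∫ W d < C`, where `C` does
not depend on `d`. As `W d` increases with `d`, a limit measure satisfies `∫ W d ≤ C` for all `d` at
once, and monotone convergence makes the series integrable. -/
theorem IsIID.exists_measure_eq_one (hX : S.IsIID X) (hCC : S.CC Ps) {f : (Fin 1 → ℝ) → ℝ}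
    (hf : CBLip f) {m : ℝ} (hu : m ≤ S.expect fun ω => f fun _ => X 0 ω)
    (hl : -(S.expect fun ω => -f fun _ => X 0 ω) ≤ m) :
    ∃ P ∈ Ps, P {ω | squareSeries X f m ω ≠ ⊤} = 1 := by
  obtain ⟨M, hM⟩ := (hf.add (CBLip.const (-m))).2
  simp_rw [← sub_eq_add_neg] at hM
  -- These weights satisfy `∑ c j * j < ∞` but `∑ c j * j² = ∞`. Division by zero gives `c 0 = 0`.
  set c : ℕ → ℝ := fun j => 1 / (j : ℝ) ^ 3 with hc
  have hc0 : ∀ j, 0 ≤ c j := fun j => by positivity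
  have hsum : Summable fun j : ℕ => c j * j := by
    refine (Real.summable_one_div_nat_pow.2 one_lt_two).congr fun j => ?_
    rcases Nat.eq_zero_or_pos j with rfl | hj
    · simp
    · have hj' : (0 : ℝ) < j := by exact_mod_cast hj
      simp only [hc]
      field_simp
  -- The `+ 1` makes the inequality in `hexp` strict, so that a measure can be chosen.
  set C : ℝ := (∑' j : ℕ, c j * j) * M ^ 2 + 1 with hC
  set W : ℕ → Ω → ℝ := fun d ω => ∑ j ∈ Finset.range d, c j * centredSum X f m j ω ^ 2 with hW
  have hWb : ∀ d, W d ∈ S.Hb := fun d =>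
    cylinders_subset_Hb hX.mem (sum_sq_mem hf m c (Nat.le_succ d))
  have hexp : ∀ d, -C < S.expect (-W d) := fun d => by
    have h1 := hX.le_expect_neg_sum_sq hf hu hl hM hc0 d 0 le_rfl
    have h2 : (fun ω => -(∑ j ∈ Finset.range d, c j * centredSum X f m j ω ^ 2)
        - 0 * centredSum X f m d ω ^ 2) = -W d := by
      ext ω
      simp [hW]
    rw [h2, zero_mul, add_zero] at h1
    have h3 := hsum.sum_le_tsum (Finset.range d) fun j _ => mul_nonneg (hc0 j) j.cast_nonneg
    have h4 := mul_le_mul_of_nonneg_right h3 (sq_nonneg M)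
    linarith
  choose Q hQ hQlt using fun d => hCC.exists_lt_integral (Hb.neg (hWb d)) (hexp d)
  obtain ⟨k, hk, P, hP, hlim⟩ := hCC.exists_subseq hWb hQ
  have hWC : ∀ d, ∫ ω, W d ω ∂P ≤ C := fun d => by
    refine le_of_tendsto (hlim d) ?_
    filter_upwards [eventually_ge_atTop d] with j hj
    have h1 := hQlt (k j)
    simp only [Pi.neg_apply, integral_neg] at h1
    refine le_trans (integral_mono (hCC.integrable (hQ _) (hWb _)) (hCC.integrable (hQ _) (hWb _))
      fun ω => ?_) (neg_lt_neg_iff.1 h1).le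
    exact Finset.sum_le_sum_of_subset_of_nonneg (Finset.range_mono (hj.trans (hk.id_le j)))
      fun i _ _ => mul_nonneg (hc0 i) (sq_nonneg _)
  have hnn : ∀ j ω, 0 ≤ c j * centredSum X f m j ω ^ 2 := fun j ω =>
    mul_nonneg (hc0 j) (sq_nonneg _)
  have hmeas : Measurable[S.sigmaH] (squareSeries X f m) :=
    (measurable_squareSeries hf m).mono (sigmaSeq_le_sigmaH hX.mem) le_rfl
  have hlint : ∫⁻ ω, squareSeries X f m ω ∂P ≤ ENNReal.ofReal C := by
    have h1 : ∀ ω, squareSeries X f m ω = ⨆ d, ENNReal.ofReal (W d ω) := fun ω => by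
      rw [squareSeries, ENNReal.tsum_eq_iSup_nat]
      refine iSup_congr fun d => (ENNReal.ofReal_sum_of_nonneg fun j _ => hnn j ω).symm
    rw [lintegral_congr h1, lintegral_iSup
      (fun d => (measurable_sigmaH (hWb d).1).ennreal_ofReal) fun d e hde ω =>
        ENNReal.ofReal_le_ofReal (Finset.sum_le_sum_of_subset_of_nonneg (Finset.range_mono hde)
          fun i _ _ => hnn i ω)]
    refine iSup_le fun d => ?_
    rw [← ofReal_integral_eq_lintegral_ofReal (hCC.integrable hP (hWb d))
      (ae_of_all _ fun ω => Finset.sum_nonneg fun i _ => hnn i ω)]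
    exact ENNReal.ofReal_le_ofReal (hWC d)
  have := hCC.isProb P hP
  refine ⟨P, hP, ?_⟩
  have hae := ae_lt_top hmeas (hlint.trans_lt ENNReal.ofReal_lt_top).ne
  rw [← measure_univ (μ := P)]
  exact measure_congr (eventuallyEq_univ.2 (hae.mono fun ω hω => hω.ne))

/-- If the two sides differ, the means between `-v` and `u` supply infinitely many disjoint events,
each of probability one under some member of `Ps`. The unions over `k ≥ n` have capacity one but
empty intersection. -/
theorem IsIID.neg_expect_neg_eq (hX : S.IsIID X) (hCC : S.CC Ps) {V : Set Ω → ℝ≥0∞}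
    (hV : ∀ A, MeasurableSet[sigmaSeq X] A → S.capP Ps A ≤ V A ∧ V A ≤ S.capHat A)
    (hpos : PosOnDecreasing {A | MeasurableSet[sigmaSeq X] A} V) {f : (Fin 1 → ℝ) → ℝ}
    (hf : CBLip f) :
    (S.expect fun ω => -f fun _ => X 0 ω) = -S.expect fun ω => f fun _ => X 0 ω := by
  have hfb : (fun ω => f fun _ => X 0 ω) ∈ S.Hb :=
    comp_mem_Hb (Z := fun _ : Fin 1 => X 0) (fun _ => hX.mem 0) hf
  set u := S.expect fun ω => f fun _ => X 0 ω with hu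
  set v := S.expect fun ω => -f fun _ => X 0 ω with hv
  have hle : -v ≤ u := neg_expect_neg_le hfb
  by_contra hne
  have hlt : 0 < u + v := by
    rcases hle.lt_or_eq with h | h
    · linarith
    · exact absurd (by linarith) hne
  -- Any sequence of distinct points of `[-v, u]` would do.
  set m : ℕ → ℝ := fun k => -v + (u + v) / (k + 1) with hm
  have hminj : Function.Injective m := fun k l hkl => by
    simp only [hm, add_right_inj] at hkl
    rw [div_eq_div_iff (by positivity) (by positivity)] at hkl
    exact_mod_cast (add_right_cancel (mul_left_cancel₀ hlt.ne' hkl)).symm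
  have hmu : ∀ k, m k ≤ u := fun k => by
    have : (u + v) / ((k : ℝ) + 1) ≤ u + v :=
      div_le_self hlt.le (le_add_of_nonneg_left k.cast_nonneg)
    simp only [hm]
    linarith
  have hml : ∀ k, -v ≤ m k := fun k => le_add_of_nonneg_right (by positivity)
  set D : ℕ → Set Ω := fun k => {ω | squareSeries X f (m k) ω ≠ ⊤} with hD
  have hDm : ∀ k, MeasurableSet[sigmaSeq X] (D k) := fun k =>
    measurable_squareSeries hf (m k) (measurableSet_singleton ⊤).compl
  have hAm : ∀ n, MeasurableSet[sigmaSeq X] (⋃ k ≥ n, D k) := fun n =>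
    MeasurableSet.iUnion fun k => MeasurableSet.iUnion fun _ => hDm k
  have h1 := hpos (fun n => ⋃ k ≥ n, D k) hAm (fun n => Set.biUnion_mono (fun k hk =>
    (Nat.le_succ n).trans hk) fun _ _ => le_rfl) fun n => by
      refine le_antisymm ((hV _ (hAm n)).2.trans (capHat_le_one _)) (le_trans ?_ (hV _ (hAm n)).1)
      obtain ⟨P, hP, hP1⟩ := hX.exists_measure_eq_one hCC hf (hmu n) (hml n)
      calc (1 : ℝ≥0∞) = P (D n) := hP1.symm
        _ ≤ P (⋃ k ≥ n, D k) := measure_mono (Set.subset_biUnion_of_mem (u := D) (le_refl n))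
        _ ≤ _ := le_iSup₂ (f := fun (P : @Measure Ω S.sigmaH) (_ : P ∈ Ps) => P _) P hP
  have h2 : ⋂ n, ⋃ k ≥ n, D k = ∅ := by
    refine Set.eq_empty_iff_forall_notMem.2 fun ω hω => ?_
    simp only [Set.mem_iInter, Set.mem_iUnion, exists_prop] at hω
    obtain ⟨k, -, hk⟩ := hω 0
    obtain ⟨l, hl, hl'⟩ := hω (k + 1)
    have := hminj (eq_of_squareSeries_ne_top hk hl')
    omega
  rw [h2] at h1
  exact h1.not_ge ((hV ∅ (@MeasurableSet.empty Ω (sigmaSeq X))).2.trans capHat_empty.le)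

end SubLinExpSpace

namespace SubLinExpSpace

variable {Ω : Type*} [MeasurableSpace Ω] {S : SubLinExpSpace Ω}
  {Ps : Set (@Measure Ω S.sigmaH)} {X : ℕ → Ω → ℝ}

/-! ### Linearity -/

/-- Split off the last variable: the one-variable case moves the sign out of the inner expectation,
and the induction hypothesis moves it out of the outer one. -/
theorem IsIID.expect_neg_of_mem_cylinders (hX : S.IsIID X)
    (h : ∀ f : (Fin 1 → ℝ) → ℝ, CBLip f →
      (S.expect fun ω => -f fun _ => X 0 ω) = -S.expect fun ω => f fun _ => X 0 ω) (n : ℕ) :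
    ∀ {Y : Ω → ℝ}, Y ∈ cylinders X n → S.expect (-Y) = -S.expect Y := by
  induction n with
  | zero =>
    rintro _ ⟨φ, -, rfl⟩
    have h0 : (fun ω => φ fun i : Fin 0 => X i ω) = fun _ => φ fun i => i.elim0 :=
      funext fun ω => congrArg φ (Subsingleton.elim _ _)
    have h1 : -(fun _ : Ω => φ fun i => i.elim0) = fun _ => -φ fun i => i.elim0 := rfl
    rw [h0, h1, expect_const, expect_const]
  | succ n ih =>
    rintro _ ⟨φ, hφ, rfl⟩
    have hψ : CBLip fun p : (Fin n → ℝ) × (Fin 1 → ℝ) => φ (Fin.snoc p.1 (p.2 0)) :=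
      hφ.comp _ fun x y => (pi_norm_le_iff_of_nonneg (norm_nonneg _)).2 fun i => by
        refine Fin.lastCases ?_ (fun i => ?_) i
        · simpa using (norm_le_pi_norm (x - y).2 0).trans (norm_snd_le (x - y))
        · simpa using (norm_le_pi_norm (x - y).1 i).trans (norm_fst_le (x - y))
    have hsnoc : ∀ ω, (fun i : Fin (n + 1) => X i ω) =
        Fin.snoc (α := fun _ => ℝ) (fun i : Fin n => X i ω) (X n ω) := fun ω => by
      ext i
      refine Fin.lastCases ?_ (fun i => ?_) i <;> simp
    have h1 := hX.expect_prod hψ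
    have h2 := hX.expect_prod hψ.neg
    have h3 : ∀ x : Fin n → ℝ, (S.expect fun ω => -φ (Fin.snoc x (X 0 ω))) =
        -S.expect fun ω => φ (Fin.snoc x (X 0 ω)) := fun x =>
      h _ (hψ.comp (fun y => (x, y)) fun y z => by simp [Prod.norm_def])
    have h4 := ih ⟨_, hψ.expect (S := S) (hX.mem 0), rfl⟩
    simp_rw [hsnoc]
    simp_rw [h3] at h2
    rw [h1, ← h4]
    exact h2

/-! ### From bounded Lipschitz functions to `ℋ̃`. -/

/-- Tightness of `(X 0, …, X (n - 1))`: the ramps `min(1, (‖x‖ - k)⁺)` decrease to `0`, so (CC)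
makes their expectations small. The ramp `k` equals `1` beyond radius `k + 1`. -/
theorem CC.exists_expect_norm_le (hCC : S.CC Ps) (hX : ∀ n, X n ∈ S.H) (n : ℕ) {δ : ℝ}
    (hδ : 0 < δ) : ∃ R : ℝ, 0 ≤ R ∧ ∃ h ∈ S.Hb, S.expect h ≤ δ ∧ (∀ ω, 0 ≤ h ω) ∧
      ∀ ω, R < ‖fun i : Fin n => X i ω‖ → 1 ≤ h ω := by
  have hY : ∀ k : ℕ, (fun ω => max 0 (min 1 (‖fun i : Fin n => X i ω‖ - k))) ∈ S.Hb := fun k => by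
    refine comp_mem_Hb (φ := fun x : Fin n → ℝ => max 0 (min 1 (‖x‖ - k))) (fun i => hX i)
      ⟨⟨1, fun x y => ?_⟩, 1, fun x => ?_⟩
    · have h1 := abs_max_sub_max_le_max 0 (min 1 (‖x‖ - k)) 0 (min 1 (‖y‖ - k))
      have h2 := abs_min_sub_min_le_max 1 (‖x‖ - k) 1 (‖y‖ - k)
      simp only [sub_self, abs_zero, abs_nonneg, sup_of_le_right, sub_sub_sub_cancel_right]
        at h1 h2
      rw [one_mul]
      exact h1.trans (h2.trans (abs_norm_sub_norm_le x y))
    · rw [abs_of_nonneg (le_max_left _ _)]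
      exact max_le zero_le_one (min_le_left _ _)
  have hanti : ∀ ω, Antitone fun k : ℕ => max 0 (min 1 (‖fun i : Fin n => X i ω‖ - k)) :=
    fun ω k l hkl => by
      have : (k : ℝ) ≤ l := by exact_mod_cast hkl
      dsimp only
      gcongr
  have hlim : ∀ ω, Tendsto (fun k : ℕ => max 0 (min 1 (‖fun i : Fin n => X i ω‖ - k))) atTop
      (𝓝 0) := fun ω => by
    refine tendsto_const_nhds.congr' ?_
    obtain ⟨N, hN⟩ := exists_nat_ge ‖fun i : Fin n => X i ω‖
    filter_upwards [eventually_ge_atTop N] with k hk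
    have : (N : ℝ) ≤ k := by exact_mod_cast hk
    rw [max_eq_left ((min_le_right _ _).trans (by linarith))]
  obtain ⟨k, hk⟩ := hCC.exists_expect_le hY hanti hlim hδ
  refine ⟨k + 1, by positivity, _, hY k, hk, fun ω => le_max_left _ _, fun ω hω => ?_⟩
  exact (le_min le_rfl (by linarith)).trans (le_max_right _ _)

/-- Clamping the arguments at radius `R` gives a bounded Lipschitz `Z`, and `|Y - Z| ≤ 2c` where it
is not zero. Each of the two comparisons costs `2c * S.expect h ≤ ε / 2`, whence the choice `ε /
(4c)`. -/
theorem CC.expect_neg_of_bounded (hCC : S.CC Ps) (hX : ∀ n, X n ∈ S.H) {n : ℕ}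
    (hcyl : ∀ Y ∈ cylinders X n, S.expect (-Y) = -S.expect Y) {φ : (Fin n → ℝ) → ℝ}
    (hφ : CLLip φ) {c : ℝ} (hc : 0 < c) (hφc : ∀ x, |φ x| ≤ c) :
    S.expect (-fun ω => φ fun i => X i ω) ≤ -S.expect fun ω => φ fun i => X i ω := by
  set Y : Ω → ℝ := fun ω => φ fun i => X i ω with hY
  have hYb : Y ∈ S.Hb := ⟨S.comp_mem n _ (fun i => hX i) φ hφ, c, fun ω => hφc _⟩
  refine le_of_forall_pos_le_add fun ε hε => ?_
  obtain ⟨R, hR, h, hh, hhδ, hh0, hh1⟩ := hCC.exists_expect_norm_le hX n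
    (show 0 < ε / (4 * c) by positivity)
  set Z : Ω → ℝ := fun ω => φ fun i => clamp R (X i ω) with hZ
  have hZc : Z ∈ cylinders X n := ⟨_, hφ.comp_clamp hR, rfl⟩
  have hZb := cylinders_subset_Hb hX hZc
  have hYZ : ∀ ω, |Y ω - Z ω| ≤ ((2 * c) • h) ω := fun ω => by
    rw [Pi.smul_apply, smul_eq_mul]
    rcases le_or_gt ‖fun i : Fin n => X i ω‖ R with hω | hω
    · have : Y ω = Z ω := congrArg φ (funext fun i =>
        (clamp_of_abs_le ((norm_le_pi_norm (fun i : Fin n => X i ω) i).trans hω)).symm)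
      rw [this, sub_self, abs_zero]
      exact mul_nonneg (by positivity) (hh0 ω)
    · have h1 := hφc fun i => X i ω
      have h2 := hφc fun i => clamp R (X i ω)
      have h3 := abs_sub (Y ω) (Z ω)
      have h4 := hh1 ω hω
      nlinarith
  have h2b := Hb.smul hh (2 * c)
  have h1 := expect_le_add_of_abs_sub_le hYb hZb h2b hYZ
  have h2 := expect_le_add_of_abs_sub_le (Hb.neg hYb) (Hb.neg hZb) h2b fun ω => by
    rw [Pi.neg_apply, Pi.neg_apply, neg_sub_neg, abs_sub_comm]
    exact hYZ ω
  rw [hcyl Z hZc] at h2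
  rw [expect_smul hh (by positivity)] at h1 h2
  have h3 : 2 * c * S.expect h ≤ ε / 2 := by
    calc 2 * c * S.expect h ≤ 2 * c * (ε / (4 * c)) := by gcongr
      _ = ε / 2 := by field_simp; norm_num
  linarith

theorem E_le_add {f g h : Ω → ℝ} (hf : f ∈ S.H) (hg : g ∈ S.Hb) (hh : h ∈ S.H)
    (hfg : ∀ ω, f ω ≤ g ω + h ω) : S.E f ≤ S.expect g + S.E h := by
  refine (S.mono _ (S.H.add_mem hg.1 hh) _ hf hfg).trans ?_
  rw [← E_eq_expect hg]
  exact S.subadd _ hg.1 _ hh (by simp [E_eq_expect hg]) (by simp [E_eq_expect hg])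

/-- For a function of the sequence with vanishing tails, `𝔼[Y]` and `𝔼[-Y]` are finite and opposite
to each other. -/
theorem CC.exists_E_eq (hCC : S.CC Ps) (hX : ∀ n, X n ∈ S.H)
    (hcyl : ∀ n, ∀ Y ∈ cylinders X n, S.expect (-Y) = -S.expect Y) {Y : Ω → ℝ}
    (hY : Y ∈ S.Htilde X hX) : ∃ r : ℝ, S.E Y = r ∧ S.E (-Y) = (-r : ℝ) := by
  obtain ⟨⟨n, -, φ, hφ, rfl⟩, hT⟩ := hY
  set Y : Ω → ℝ := fun ω => φ fun i => X i ω with hYdef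
  have hYH : Y ∈ S.H := S.comp_mem n _ (fun i => hX i) φ hφ
  -- Truncation of `Y` at level `c` costs a tail of expectation below `ε / 2` for `Y` and again for
  -- `-Y`; `a` is the truncated expectation plus `ε / 2`.
  have key : ∀ ε : ℝ, 0 < ε → ∃ a : ℝ, S.E Y ≤ (a : ℝ) ∧ S.E (-Y) ≤ (-a + ε : ℝ) := fun ε hε => by
    obtain ⟨c, hcT, hc⟩ := ((hT.eventually_lt_const (EReal.coe_pos.2 (half_pos hε))).and
      (eventually_gt_atTop 0)).exists
    have hcl := Hb.clamp hYH hc.le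
    have h1 := hCC.expect_neg_of_bounded hX (hcyl n)
      (hφ.of_lipschitz_comp _ (abs_clamp_sub_clamp_le c)) hc fun x => abs_clamp_le hc.le _
    have htail := tail_mem hYH c
    have h2 := E_le_add hYH hcl htail fun ω => by
      have := (abs_le.1 (abs_sub_clamp_le hc.le (Y ω))).2
      linarith
    have h3 := E_le_add (S.H.neg_mem hYH) (Hb.neg hcl) htail fun ω => by
      have := (abs_le.1 (abs_sub_clamp_le hc.le (Y ω))).1
      simp only [Pi.neg_apply]
      linarith
    refine ⟨S.expect (fun ω => clamp c (Y ω)) + ε / 2, h2.trans ?_, h3.trans ?_⟩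
    · rw [EReal.coe_add]
      gcongr
    · calc _ ≤ ((S.expect (-fun ω => clamp c (Y ω)) : ℝ) : EReal) + ((ε / 2 : ℝ) : EReal) := by
            gcongr
        _ ≤ _ := by
          rw [← EReal.coe_add, EReal.coe_le_coe_iff]
          linarith
  obtain ⟨a, ha, ha'⟩ := key 1 one_pos
  have htop : S.E Y ≠ ⊤ := (ha.trans_lt (EReal.coe_lt_top _)).ne
  have htop' : S.E (-Y) ≠ ⊤ := (ha'.trans_lt (EReal.coe_lt_top _)).ne
  -- This gives `0 ≤ 𝔼[Y] + 𝔼[-Y]`, which excludes the value `⊥` for both terms.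
  have hsum := S.subadd Y hYH (-Y) (S.H.neg_mem hYH) (fun h => htop h.1) (fun h => htop' h.2)
  rw [add_neg_cancel, show S.E 0 = 0 from S.const 0] at hsum
  have hbot : S.E Y ≠ ⊥ := fun h => by simp [h] at hsum
  have hbot' : S.E (-Y) ≠ ⊥ := fun h => by simp [h] at hsum
  lift S.E Y to ℝ using ⟨htop, hbot⟩ with r hr
  lift S.E (-Y) to ℝ using ⟨htop', hbot'⟩ with q hq
  refine ⟨r, rfl, ?_⟩
  rw [EReal.coe_eq_coe_iff]
  rw [← EReal.coe_add, EReal.coe_nonneg] at hsum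
  refine le_antisymm (le_of_forall_pos_le_add fun ε hε => ?_) (by linarith)
  obtain ⟨b, hb, hb'⟩ := key ε hε
  rw [EReal.coe_le_coe_iff] at hb hb'
  linarith

/-- Sub-additivity applied to `-Y` and `-Z` is super-additivity for `Y` and `Z` once signs may be
pulled out; negative scalars are treated in the same way. -/
theorem linearOn_of_exists_E_eq {W : Submodule ℝ (Ω → ℝ)} (hW : W ≤ S.H)
    (h : ∀ Y ∈ W, ∃ r : ℝ, S.E Y = r ∧ S.E (-Y) = (-r : ℝ)) : S.LinearOn W := by
  have hcoe : ∀ {Y}, Y ∈ W → S.E Y = S.expect Y := fun hY => by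
    obtain ⟨r, hr, -⟩ := h _ hY
    rw [expect, hr, EReal.toReal_coe]
  have hneg : ∀ {Y}, Y ∈ W → S.expect (-Y) = -S.expect Y := fun hY => by
    obtain ⟨r, hr, hr'⟩ := h _ hY
    rw [expect, expect, hr, hr', EReal.toReal_coe, EReal.toReal_coe]
  have hadd : ∀ {Y Z}, Y ∈ W → Z ∈ W → S.expect (Y + Z) ≤ S.expect Y + S.expect Z := fun hY hZ => by
    have := S.subadd _ (hW hY) _ (hW hZ) (by simp [hcoe hY]) (by simp [hcoe hY])
    rwa [hcoe hY, hcoe hZ, hcoe (W.add_mem hY hZ), ← EReal.coe_add, EReal.coe_le_coe_iff] at this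
  have hsmul : ∀ {Y} {a : ℝ}, Y ∈ W → 0 ≤ a → S.expect (a • Y) = a * S.expect Y := fun hY ha => by
    have := S.pos_homog _ (hW hY) _ ha
    rwa [hcoe hY, hcoe (W.smul_mem _ hY), ← EReal.coe_mul, EReal.coe_eq_coe_iff] at this
  refine ⟨{ toFun := fun Y => S.expect Y, map_add' := fun Y Z => ?_, map_smul' := fun a Y => ?_ },
    fun Y => hcoe Y.2⟩
  · refine le_antisymm (hadd Y.2 Z.2) ?_
    have h1 := hadd (W.neg_mem Y.2) (W.neg_mem Z.2)
    rw [← neg_add, hneg (W.add_mem Y.2 Z.2), hneg Y.2, hneg Z.2] at h1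
    change _ ≤ S.expect (Y + Z : Ω → ℝ)
    linarith
  · change S.expect (a • (Y : Ω → ℝ)) = a * S.expect Y
    rcases le_total 0 a with ha | ha
    · exact hsmul Y.2 ha
    · rw [← neg_smul_neg, hsmul (W.neg_mem Y.2) (neg_nonneg.2 ha), hneg Y.2, neg_mul_neg]

theorem Htilde_le (hX : ∀ n, X n ∈ S.H) : S.Htilde X hX ≤ S.H := by
  rintro _ ⟨⟨n, -, φ, hφ, rfl⟩, -⟩
  exact S.comp_mem n _ (fun i => hX i) φ hφ

theorem IsIID.linearOn_Htilde (hX : S.IsIID X) (hCC : S.CC Ps) {V : Set Ω → ℝ≥0∞}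
    (hV : ∀ A, MeasurableSet[S.sigmaH] A → S.capP Ps A ≤ V A ∧ V A ≤ S.capHat A)
    (hpos : PosOnDecreasing {A | MeasurableSet[sigmaSeq X] A} V) :
    S.LinearOn (S.Htilde X hX.mem) :=
  linearOn_of_exists_E_eq (Htilde_le hX.mem) fun _ hY => hCC.exists_E_eq hX.mem
    (fun n _ hZ => hX.expect_neg_of_mem_cylinders (fun _ hf => hX.neg_expect_neg_eq hCC
      (fun A hA => hV A (sigmaSeq_le_sigmaH hX.mem A hA)) hpos hf) n hZ) hY

end SubLinExpSpace

open SubLinExpSpace in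
theorem mainTheorem9 {Ω : Type*} [MeasurableSpace Ω] (S : SubLinExpSpace Ω)
    (X : ℕ → Ω → ℝ) (hX : S.IsIID X)
    (Ps : Set (@MeasureTheory.Measure Ω S.sigmaH)) (hCC : S.CC Ps) :
    (S.Brackets {A | MeasurableSet[S.sigmaH] A} (S.capP Ps) ∧ S.Brackets {A | MeasurableSet A} S.capC ∧
      S.Brackets {A | MeasurableSet A} S.capHatStar ∧ S.Brackets {A | MeasurableSet A} S.capHat) ∧
    (∀ V ∈ ({S.capP Ps, S.capC, S.capHatStar, S.capHat} : Set (Set Ω → ENNReal)),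
      SubLinExpSpace.PosOnDecreasing {A | MeasurableSet[SubLinExpSpace.sigmaSeq X] A} V →
        S.LinearOn (S.Htilde X hX.mem)) := by
  have h1 : ∀ A, MeasurableSet[S.sigmaH] A → S.capP Ps A ≤ S.capC A := fun _ => hCC.capP_le_capC
  have h2 : ∀ A, S.capC A ≤ S.capHatStar A := capC_le_capHatStar
  have h3 : ∀ A, MeasurableSet A → S.capHatStar A ≤ S.capHat A := fun _ => capHatStar_le_capHat
  have h3' : ∀ A, MeasurableSet[S.sigmaH] A → S.capHatStar A ≤ S.capHat A := fun A hA =>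
    h3 A (sigmaH_le A hA)
  refine ⟨⟨hCC.brackets_capP, hCC.brackets_of_le fun A hA => ⟨le_rfl, (h2 A).trans (h3 A hA)⟩,
    hCC.brackets_of_le fun A hA => ⟨h2 A, h3 A hA⟩,
    hCC.brackets_of_le fun A hA => ⟨(h2 A).trans (h3 A hA), le_rfl⟩⟩, ?_⟩
  rintro V (rfl | rfl | rfl | rfl) hpos
  · exact hX.linearOn_Htilde hCC (fun A hA =>
      ⟨le_rfl, (h1 A hA).trans ((h2 A).trans (h3' A hA))⟩) hpos
  · exact hX.linearOn_Htilde hCC (fun A hA => ⟨h1 A hA, (h2 A).trans (h3' A hA)⟩) hpos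
  · exact hX.linearOn_Htilde hCC (fun A hA => ⟨(h1 A hA).trans (h2 A), h3' A hA⟩) hpos
  · exact hX.linearOn_Htilde hCC (fun A hA =>
      ⟨(h1 A hA).trans ((h2 A).trans (h3' A hA)), le_rfl⟩) hpos
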